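/- **Theorem 2 (Generalizing formula).** Let $X=(X_1,\dots,X_N)$ be an $N$-dimensional Gaussian random vector with mean vector $\mu=(\mu_i)$ and covariance matrix $C=(C_{ij})$ (possibly singular), and write $\sigma_i^2:=C_{ii}$. Let $n=(n_1,\dots,n_N)$ be nonnegative integers, $|n|=\sum_i n_i$, and let $g:\mathbb{R}^N\to\mathbb{R}$ be of class $C^{|n|}$. Assume that all expectations appearing in the formula below exist, i.e. that the random variables inside them are integrable. Then $$ \mathbb{E}\Big[g(X)\prod_{i=1}^N X_i^{n_i}\Big]=\sum_{\substack{r_i+\sum_{j=1}^N\ell_{ij}=n_i\\ i=1,\dots,N}}\Big[\prod_{i=1}^N\binom{n_i}{r_i,\ell_{i1},\dots,\ell_{iN}}\Big]\Big(\prod_{i=1}^N\mu_i^{r_i}\Big)\sum_{k}\Big(\prod_{i=1}^N H_{\ell_{ii},k_{ii}}\,\sigma_i^{2(\ell_{ii}-k_{ii})}\Big)\Big(\prod_{1\le i<j\le N} G_{\ell_{ij},\ell_{ji},k_{ij}}\,C_{ij}^{\,\ell_{ij}+\ell_{ji}-k_{ij}}\Big)\,\mathbb{E}\big[\partial_1^{a_1}\cdots\partial_N^{a_N}g(X)\big].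 $$ The outer sum is over all families of nonnegative integers $r_i,\ell_{ij}$ ($1\le i,j\le N$) with $r_i+\sum_{j}\ell_{ij}=n_i$ for every $i$. The inner sum is over all symmetric arrays $k=(k_{ij})$ of integers ($k_{ij}=k_{ji}$) with $0\le k_{ii}\le\lfloor\ell_{ii}/2\rfloor$ and $0\le k_{ij}\le\min\{\ell_{ij},\ell_{ji}\}$ for $i\ne j$. Here $\binom{m}{r,\ell_1,\dots,\ell_N}=\frac{m!}{r!\,\ell_1!\cdots\ell_N!}$, $$ H_{\ell,k}=\frac{\ell!}{2^k\,k!\,(\ell-2k)!},\qquad G_{\ell_1,\ell_2,k}=\binom{\ell_1}{k}\binom{\ell_2}{k}k!, $$ and the orders of the partial derivatives are $$ a_i=\sum_{j=1}^N\big[\ell_{ji}-(1+\delta_{ij})k_{ij}\big],\qquad i=1,\dots,N, $$ with $\delta_{ij}$ the Kronecker delta. -/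

import Mathlib

open MeasureTheory ProbabilityTheory

noncomputable section

namespace GaussianFormula

/-- The partial derivative `∂ᵢ f` on `ℝ^N`: the derivative along the `i`-th coordinate vector. -/
def partialDeriv {N : ℕ} (i : Fin N) (f : (Fin N → ℝ) → ℝ) : (Fin N → ℝ) → ℝ :=
  fun x => lineDeriv ℝ f x (Pi.single i 1)

/-- The mixed partial derivative `∂₁^{a₁} ⋯ ∂_N^{a_N} g`. -/
def mixedPartial {N : ℕ} (a : Fin N → ℕ) (g : (Fin N → ℝ) → ℝ) : (Fin N → ℝ) → ℝ :=
  (List.finRange N).foldr (fun i f => (partialDeriv i)^[a i] f) g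

/-- `H_{ℓ,k} = ℓ! / (2^k k! (ℓ-2k)!)`, used for `k ≤ ⌊ℓ/2⌋`. -/
def coeffH (l k : ℕ) : ℝ :=
  (l.factorial : ℝ) / (2 ^ k * (k.factorial : ℝ) * ((l - 2 * k).factorial : ℝ))

/-- `G_{ℓ₁,ℓ₂,k} = C(ℓ₁,k) C(ℓ₂,k) k!`, used for `k ≤ min(ℓ₁,ℓ₂)`. -/
def coeffG (l₁ l₂ k : ℕ) : ℝ :=
  (l₁.choose k : ℝ) * (l₂.choose k : ℝ) * (k.factorial : ℝ)

/-- The multinomial coefficient `n! / (r! ℓ₁! ⋯ ℓ_N!)`. -/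
def multinomialCoeff {N : ℕ} (n r : ℕ) (l : Fin N → ℕ) : ℝ :=
  (n.factorial : ℝ) / ((r.factorial : ℝ) * ∏ j, ((l j).factorial : ℝ))

/-- All families `(r, ℓ)` of nonnegative integers with `rᵢ + ∑ⱼ ℓᵢⱼ = nᵢ` for every `i`
(the ranges only make the set visibly finite). -/
def decompositions {N : ℕ} (n : Fin N → ℕ) :
    Finset ((Fin N → ℕ) × (Fin N → Fin N → ℕ)) :=
  ((Fintype.piFinset fun i => Finset.range (n i + 1)) ×ˢ
    (Fintype.piFinset fun i => Fintype.piFinset fun _ => Finset.range (n i + 1))).filter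
    fun p => ∀ i, p.1 i + ∑ j, p.2 i j = n i

/-- The largest value of `kᵢⱼ`: `⌊ℓᵢᵢ/2⌋` on the diagonal and `min(ℓᵢⱼ, ℓⱼᵢ)` off it. -/
def maxPairing {N : ℕ} (l : Fin N → Fin N → ℕ) (i j : Fin N) : ℕ :=
  if i = j then l i i / 2 else min (l i j) (l j i)

/-- All arrays `k` with `kᵢⱼ = kⱼᵢ`, `0 ≤ kᵢᵢ ≤ ⌊ℓᵢᵢ/2⌋` and `0 ≤ kᵢⱼ ≤ min(ℓᵢⱼ, ℓⱼᵢ)`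
for `i ≠ j`. -/
def pairings {N : ℕ} (l : Fin N → Fin N → ℕ) : Finset (Fin N → Fin N → ℕ) :=
  (Fintype.piFinset fun i => Fintype.piFinset fun j => Finset.range (maxPairing l i j + 1)).filter
    fun k => ∀ i j, k i j = k j i

/-- The orders `aᵢ = ∑ⱼ [ℓⱼᵢ - (1 + δᵢⱼ) kᵢⱼ]`. For `k ∈ pairings ℓ` no subtraction truncates. -/
def derivOrder {N : ℕ} (l k : Fin N → Fin N → ℕ) (i : Fin N) : ℕ :=
  ∑ j, (l j i - (1 + if i = j then 1 else 0) * k i j)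

end GaussianFormula

end

open GaussianFormula

/-! The engine is Stein's identity `E[Xⱼ f(X)] = μⱼ E[f(X)] + ∑ᵢ Cⱼᵢ E[∂ᵢf(X)]`. Applied to `f = x^b
∂^a g`, it replaces one factor `Xⱼ` by its mean, pairs it with another factor `Xᵢ`, or turns it into
a derivative `∂ᵢ`. Formally, with `D = (∂₁, …, ∂_N)`, `E[exp(t·X) g(X)] = E[exp(t·μ + t·Ct/2 + t·CD)
g(X)]`, and the theorem compares coefficients of `t^n`.

The coefficients of the right-hand exponential are polynomials in `D` obeying Euler's recursion
(`smul_exponentialCoeff_block`). Stein's identity gives the moments the same recursion, whence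
`integral_monomial_mul_mixedPartial`. Expanding the exponential gives a sum over multiplicities of
blocks. If `kᵢⱼ` counts the pairs `{i, j}` and `ℓᵢⱼ - (1 + δᵢⱼ) kᵢⱼ` the factors `Xᵢ` turned into
`∂ⱼ`, it becomes the stated double sum (`sum_weightedMultiplicities`), with `H` and `G` absorbing
the factorials.

Two analytic points remain. Stein's identity is needed with no growth condition, only integrability
of `f(X)` and `∂ᵢf(X)`; this rests on `integrable_id_mul_gaussianReal`. And `C` may be singular, so
`X` need not have a density; regression on `Xⱼ` reduces to one dimension. -/

namespace GaussianFormula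

open Filter
open scoped NNReal

/-! ### Stein's identity on the line, without growth conditions -/

section Stein1D

variable {v : ℝ≥0}

lemma integrable_gaussianReal_iff (hv : v ≠ 0) {f : ℝ → ℝ} :
    Integrable f (gaussianReal 0 v) ↔ Integrable fun x => gaussianPDFReal 0 v x * f x := by
  rw [gaussianReal_of_var_ne_zero _ hv, integrable_withDensity_iff_integrable_smul'
    (measurable_gaussianPDF 0 v) (by simp [gaussianPDF_lt_top])]
  simp [toReal_gaussianPDF]

lemma hasDerivAt_gaussianPDFReal_zero (hv : v ≠ 0) (x : ℝ) :
    HasDerivAt (gaussianPDFReal 0 v) (-(x / v) * gaussianPDFReal 0 v x) x := by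
  have hv' : (v : ℝ) ≠ 0 := by exact_mod_cast hv
  rw [gaussianPDFReal_def]
  have h : HasDerivAt (fun x : ℝ => -(x - 0) ^ 2 / (2 * v)) (-(x / v)) x := by
    have := (((hasDerivAt_id x).sub_const 0).pow 2).neg.div_const (2 * (v : ℝ))
    refine this.congr_deriv ?_
    simp
    field_simp
  refine (h.exp.const_mul _).congr_deriv ?_
  ring

lemma continuous_gaussianPDFReal_zero (hv : v ≠ 0) : Continuous (gaussianPDFReal 0 v) :=
  continuous_iff_continuousAt.2 fun x => (hasDerivAt_gaussianPDFReal_zero hv x).continuousAt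

/-- Integrating by parts over `[-R, R]` leaves the boundary term `-v [Qφ]`. The sign condition makes
it nonpositive, so the integrals of the nonnegative function `x Q φ` are bounded uniformly in `R`.
-/
lemma integrable_id_mul_gaussianReal_of_nonneg (hv : v ≠ 0) {Q Q' : ℝ → ℝ}
    (hQ : ∀ x, HasDerivAt Q (Q' x) x) (hQ' : Continuous Q') (hpos : ∀ x, 0 ≤ x * Q x)
    (hint : Integrable Q' (gaussianReal 0 v)) :
    Integrable (fun x => x * Q x) (gaussianReal 0 v) ∧
      ∫ x, x * Q x ∂gaussianReal 0 v ≤ v * ∫ x, |Q' x| ∂gaussianReal 0 v := by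
  have hv' : (v : ℝ) ≠ 0 := by exact_mod_cast hv
  set φ := gaussianPDFReal 0 v with hφ
  have hφc : Continuous φ := continuous_gaussianPDFReal_zero hv
  have hφ0 : ∀ x, 0 ≤ φ x := gaussianPDFReal_nonneg 0 v
  have hQc : Continuous Q := continuous_iff_continuousAt.2 fun x => (hQ x).continuousAt
  rw [integral_gaussianReal_eq_integral_smul hv, integral_gaussianReal_eq_integral_smul hv,
    integrable_gaussianReal_iff hv]
  rw [integrable_gaussianReal_iff hv] at hint
  simp only [smul_eq_mul]
  have habs : Integrable fun x => φ x * |Q' x| := by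
    refine hint.abs.congr (ae_of_all _ fun x => ?_)
    change |φ x * Q' x| = φ x * |Q' x|
    rw [abs_mul, abs_of_nonneg (hφ0 x)]
  have key : ∀ R : ℝ, 0 ≤ R → ∫ x in (-R)..R, φ x * (x * Q x) ≤ v * ∫ x, φ x * |Q' x| := by
    intro R hR
    have hd : ∀ x, HasDerivAt (fun x => -(v : ℝ) * (Q x * φ x))
        (φ x * (x * Q x) - v * (φ x * Q' x)) x := by
      intro x
      refine (((hQ x).mul (hasDerivAt_gaussianPDFReal_zero hv x)).const_mul _).congr_deriv ?_
      field_simp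
      ring
    have hftc := intervalIntegral.integral_eq_sub_of_hasDerivAt (a := -R) (b := R)
      (fun x _ => hd x) (Continuous.intervalIntegrable (by fun_prop) _ _)
    rw [intervalIntegral.integral_sub (Continuous.intervalIntegrable (by fun_prop) _ _)
      (Continuous.intervalIntegrable (by fun_prop) _ _), intervalIntegral.integral_const_mul]
      at hftc
    have hb1 : 0 ≤ Q R * φ R := by
      refine mul_nonneg ?_ (hφ0 R)
      rcases hR.eq_or_lt with rfl | h
      -- At `0` the sign condition is void; the sign of `Q 0` comes from `x > 0` by continuity.
      · have h0 : Tendsto Q (nhdsWithin 0 (Set.Ioi 0)) (nhds (Q 0)) :=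
          (hQc.tendsto 0).mono_left nhdsWithin_le_nhds
        refine ge_of_tendsto h0 ?_
        filter_upwards [self_mem_nhdsWithin] with x hx
        exact nonneg_of_mul_nonneg_right (hpos x) hx
      · exact nonneg_of_mul_nonneg_right (hpos R) h
    have hb2 : Q (-R) * φ (-R) ≤ 0 := by
      refine mul_nonpos_of_nonpos_of_nonneg ?_ (hφ0 _)
      rcases hR.eq_or_lt with rfl | h
      · have h0 : Tendsto Q (nhdsWithin 0 (Set.Iio 0)) (nhds (Q 0)) :=
          (hQc.tendsto 0).mono_left nhdsWithin_le_nhds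
        rw [neg_zero]
        refine le_of_tendsto h0 ?_
        filter_upwards [self_mem_nhdsWithin] with x hx
        have := hpos x
        by_contra! h
        have := mul_neg_of_neg_of_pos hx h
        linarith
      · by_contra! h'
        have := hpos (-R)
        nlinarith
    have hle : ∫ x in (-R)..R, φ x * Q' x ≤ ∫ x, φ x * |Q' x| := by
      rw [intervalIntegral.integral_of_le (by linarith)]
      calc ∫ x in Set.Ioc (-R) R, φ x * Q' x ≤ ∫ x in Set.Ioc (-R) R, φ x * |Q' x| := by
            refine integral_mono hint.integrableOn habs.integrableOn fun x => ?_
            exact mul_le_mul_of_nonneg_left (le_abs_self _) (hφ0 x)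
        _ ≤ _ := setIntegral_le_integral habs
            (ae_of_all _ fun x => mul_nonneg (hφ0 x) (abs_nonneg _))
    have := mul_le_mul_of_nonneg_left hle v.2
    have h1 := mul_nonneg v.2 hb1
    have h2 := mul_nonneg v.2 (neg_nonneg.2 hb2)
    simp only [NNReal.val_eq_coe] at this h1 h2
    linarith
  have hnn : ∀ x, 0 ≤ φ x * (x * Q x) := fun x => mul_nonneg (hφ0 x) (hpos x)
  have hI : Integrable fun x => φ x * (x * Q x) := by
    refine integrable_of_intervalIntegral_norm_bounded (l := atTop (α := ℝ))
      (v * ∫ x, φ x * |Q' x|) (a := fun R => -R) (b := fun R => R)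
      (fun R => (Continuous.integrableOn_Icc (by fun_prop)).mono_set Set.Ioc_subset_Icc_self)
      tendsto_neg_atTop_atBot tendsto_id ?_
    filter_upwards [eventually_ge_atTop 0] with R hR
    refine le_trans (le_of_eq ?_) (key R hR)
    congr 1; ext x; exact Real.norm_of_nonneg (hnn x)
  refine ⟨hI, le_of_tendsto (intervalIntegral_tendsto_integral hI tendsto_neg_atTop_atBot
    tendsto_id) ?_⟩
  filter_upwards [eventually_ge_atTop 0] with R hR using key R hR

lemma hasDerivAt_sqrt_sq_add_one {h : ℝ → ℝ} {h' x : ℝ} (hh : HasDerivAt h h' x) :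
    HasDerivAt (fun x => √(h x ^ 2 + 1)) (h x * h' / √(h x ^ 2 + 1)) x := by
  have := ((hh.pow 2).add_const 1).sqrt (add_pos_of_nonneg_of_pos (sq_nonneg _) one_pos).ne'
  refine this.congr_deriv ?_
  simp; ring

lemma abs_le_sqrt_sq_add_one (x : ℝ) : |x| ≤ √(x ^ 2 + 1) :=
  Real.abs_le_sqrt (by linarith)

lemma one_le_sqrt_sq_add_one (x : ℝ) : 1 ≤ √(x ^ 2 + 1) :=
  Real.le_sqrt_of_sq_le (by nlinarith [sq_nonneg x])

lemma sqrt_sq_add_one_le (x : ℝ) : √(x ^ 2 + 1) ≤ |x| + 1 := by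
  rw [Real.sqrt_le_left (by positivity), ← sq_abs x]
  nlinarith [abs_nonneg x]

/-- With `s x = √(x² + 1)`, the function `Q x = (x / s x) * s (h x)` is a smooth substitute for
`sign x * |h x|`. It satisfies `x Q ≥ 0`, `|Q'| ≤ |h| + 1 + |h'|` and `|x h| ≤ |h| + 1 + x Q`, so
the sign-restricted case applies. The explicit bound is what Fubini needs later. -/
lemma integrable_id_mul_gaussianReal (hv : v ≠ 0) {h h' : ℝ → ℝ}
    (hh : ∀ x, HasDerivAt h (h' x) x) (hh' : Continuous h')
    (hi : Integrable h (gaussianReal 0 v)) (hi' : Integrable h' (gaussianReal 0 v)) :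
    Integrable (fun x => x * h x) (gaussianReal 0 v) ∧
      ∫ x, |x * h x| ∂gaussianReal 0 v ≤
        (1 + v) * (∫ x, |h x| ∂gaussianReal 0 v + 1) + v * ∫ x, |h' x| ∂gaussianReal 0 v := by
  have hc : Continuous h := continuous_iff_continuousAt.2 fun x => (hh x).continuousAt
  set s : ℝ → ℝ := fun x => √(x ^ 2 + 1) with hs
  have hs0 : ∀ x, s x ≠ 0 := fun x => by
    have := one_le_sqrt_sq_add_one x
    simp only [hs]; linarith
  have hsc : Continuous s := by fun_prop
  have hs1 : ∀ x, 1 ≤ s x := one_le_sqrt_sq_add_one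
  have hs2 : ∀ x, s x ^ 2 = x ^ 2 + 1 := fun x => Real.sq_sqrt (by positivity)
  have hsa : ∀ x, |x| ≤ s x := abs_le_sqrt_sq_add_one
  have hsle : ∀ x, s x ≤ |x| + 1 := sqrt_sq_add_one_le
  have hsp : ∀ x, 0 < s x := fun x => by linarith [hs1 x]
  have hq : ∀ x, HasDerivAt (fun x => x / s x) (1 / (s x) ^ 3) x := by
    intro x
    have := (hasDerivAt_id x).div (hasDerivAt_sqrt_sq_add_one (hasDerivAt_id x)) (hs0 x)
    refine this.congr_deriv ?_
    have h1 := hs0 x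
    have h2 := hs2 x
    simp only [hs, id] at h1 h2 ⊢
    field_simp
    rw [h2]; ring
  have hQ : ∀ x, HasDerivAt (fun x => x / s x * s (h x))
      (1 / (s x) ^ 3 * s (h x) + x / s x * (h x * h' x / s (h x))) x := fun x =>
    (hq x).mul (hasDerivAt_sqrt_sq_add_one (hh x))
  have hQc : Continuous fun x => 1 / (s x) ^ 3 * s (h x) + x / s x * (h x * h' x / s (h x)) := by
    have a1 : ∀ x, s x ^ 3 ≠ 0 := fun x => pow_ne_zero _ (hs0 x)
    have a2 : ∀ x, s (h x) ≠ 0 := fun x => hs0 _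
    fun_prop (disch := assumption)
  have hpos : ∀ x, 0 ≤ x * (x / s x * s (h x)) := fun x => by
    have : x * (x / s x * s (h x)) = x ^ 2 / s x * s (h x) := by ring
    rw [this]
    exact mul_nonneg (div_nonneg (sq_nonneg x) (hsp x).le) (hsp _).le
  have hbd : ∀ x, |1 / (s x) ^ 3 * s (h x) + x / s x * (h x * h' x / s (h x))| ≤
      (|h x| + 1) + |h' x| := by
    intro x
    refine (abs_add_le _ _).trans (add_le_add ?_ ?_)
    · rw [abs_mul, abs_of_nonneg (hsp (h x)).le, abs_of_nonneg (by have := hsp x; positivity)]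
      refine (mul_le_of_le_one_left (hsp _).le ?_).trans (hsle _)
      rw [div_le_one (by have := hsp x; positivity)]
      exact one_le_pow₀ (hs1 x)
    · rw [abs_mul, abs_div, abs_div, abs_mul, abs_of_pos (hsp x), abs_of_pos (hsp (h x))]
      refine (mul_le_of_le_one_left (by have := hsp (h x); positivity)
        ((div_le_one (hsp x)).2 (hsa x))).trans ?_
      rw [div_le_iff₀ (hsp _), mul_comm]
      exact mul_le_mul_of_nonneg_left (hsa _) (abs_nonneg _)
  have h1 : Integrable (fun x => |h x| + 1) (gaussianReal 0 v) :=
    hi.abs.add (integrable_const 1)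
  have hB : Integrable (fun x => (|h x| + 1) + |h' x|) (gaussianReal 0 v) := h1.add hi'.abs
  have hQi := hB.mono' hQc.aestronglyMeasurable (ae_of_all _ hbd)
  obtain ⟨hA, hAle⟩ := integrable_id_mul_gaussianReal_of_nonneg hv hQ hQc hpos hQi
  have hdom : ∀ x, |x * h x| ≤ (|h x| + 1) + x * (x / s x * s (h x)) := by
    intro x
    have h1 : |x| ≤ 1 + x ^ 2 / s x := by
      have : x ^ 2 / s x = s x - 1 / s x := by
        have := hs0 x
        field_simp
        linarith [hs2 x]
      rw [this]
      have : 1 / s x ≤ 1 := (div_le_one (hsp x)).2 (hs1 x)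
      linarith [hsa x]
    calc |x * h x| = |x| * |h x| := abs_mul _ _
      _ ≤ (1 + x ^ 2 / s x) * s (h x) := mul_le_mul h1 (hsa _) (abs_nonneg _)
          (add_nonneg zero_le_one (div_nonneg (sq_nonneg x) (hsp x).le))
      _ = s (h x) + x * (x / s x * s (h x)) := by ring
      _ ≤ _ := by linarith [hsle (h x)]
  have hD : Integrable (fun x => (|h x| + 1) + x * (x / s x * s (h x))) (gaussianReal 0 v) :=
    h1.add hA
  have hX : Integrable (fun x => x * h x) (gaussianReal 0 v) :=
    hD.mono' (by fun_prop) (ae_of_all _ hdom)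
  refine ⟨hX, ?_⟩
  have e1 : ∫ x, |h x| + 1 ∂gaussianReal 0 v = ∫ x, |h x| ∂gaussianReal 0 v + 1 := by
    rw [integral_add hi.abs (integrable_const 1)]; simp
  have i1 := integral_mono hX.abs hD hdom
  rw [integral_add h1 hA] at i1
  have i2 := integral_mono hQi.abs hB hbd
  rw [integral_add h1 hi'.abs] at i2
  rw [e1] at i1 i2
  have i3 := mul_le_mul_of_nonneg_left i2 v.2
  simp only [NNReal.val_eq_coe] at i3
  linarith

lemma integral_id_mul_gaussianReal (hv : v ≠ 0) {h h' : ℝ → ℝ}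
    (hh : ∀ x, HasDerivAt h (h' x) x) (hh' : Continuous h')
    (hi : Integrable h (gaussianReal 0 v)) (hi' : Integrable h' (gaussianReal 0 v)) :
    ∫ x, x * h x ∂gaussianReal 0 v = v * ∫ x, h' x ∂gaussianReal 0 v := by
  have hv' : (v : ℝ) ≠ 0 := by exact_mod_cast hv
  have hx := (integrable_id_mul_gaussianReal hv hh hh' hi hi').1
  rw [integrable_gaussianReal_iff hv] at hx hi hi'
  rw [integral_gaussianReal_eq_integral_smul hv, integral_gaussianReal_eq_integral_smul hv]
  have := integral_mul_deriv_eq_deriv_mul_of_integrable (u := h) (u' := h')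
    (v := gaussianPDFReal 0 v) (fun x _ => hh x)
    (fun x _ => hasDerivAt_gaussianPDFReal_zero hv x)
    ((hx.const_mul (-(v : ℝ)⁻¹)).congr (ae_of_all _ fun x => by simp; ring))
    (hi'.congr (ae_of_all _ fun x => mul_comm _ _))
    (hi.congr (ae_of_all _ fun x => mul_comm _ _))
  have e1 : ∫ x, h x * (-(x / v) * gaussianPDFReal 0 v x) =
      -(v : ℝ)⁻¹ * ∫ x, gaussianPDFReal 0 v x • (x * h x) := by
    rw [← integral_const_mul]
    congr 1; ext x; simp; ring
  have e2 : ∫ x, h' x * gaussianPDFReal 0 v x = ∫ x, gaussianPDFReal 0 v x • h' x := by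
    congr 1; ext x; simp; ring
  rw [e1, e2] at this
  field_simp at this
  linarith

end Stein1D

/-! ### Stein's identity along a random line -/

section SteinProd

variable {v : ℝ≥0} {E : Type*} [NormedAddCommGroup E] [NormedSpace ℝ E]

lemma hasDerivAt_comp_line {f : E → ℝ} (hf : ContDiff ℝ 1 f) (u y : E) (z : ℝ) :
    HasDerivAt (fun z : ℝ => f (y + z • u)) (fderiv ℝ f (y + z • u) u) z := by
  have h1 : HasDerivAt (fun z : ℝ => y + z • u) u z := by
    simpa using ((hasDerivAt_id z).smul_const u).const_add y
  exact ((hf.differentiable one_ne_zero).differentiableAt.hasFDerivAt.comp_hasDerivAt z h1)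

variable [MeasurableSpace E] [BorelSpace E] [SecondCountableTopology E]

/-- Gaussian integration by parts along a line, with the base point independent of the
Gaussian coordinate. -/
theorem stein_prod (hv : v ≠ 0) (ν : Measure E) [IsFiniteMeasure ν] (u : E) {f : E → ℝ}
    (hf : ContDiff ℝ 1 f)
    (hi : Integrable (fun p : E × ℝ => f (p.1 + p.2 • u)) (ν.prod (gaussianReal 0 v)))
    (hi' : Integrable (fun p : E × ℝ => fderiv ℝ f (p.1 + p.2 • u) u)
      (ν.prod (gaussianReal 0 v))) :
    Integrable (fun p : E × ℝ => p.2 * f (p.1 + p.2 • u)) (ν.prod (gaussianReal 0 v)) ∧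
      ∫ p, p.2 * f (p.1 + p.2 • u) ∂ν.prod (gaussianReal 0 v) =
        v * ∫ p, fderiv ℝ f (p.1 + p.2 • u) u ∂ν.prod (gaussianReal 0 v) := by
  have hfc : Continuous f := hf.continuous
  have hdc : Continuous fun x => fderiv ℝ f x u :=
    (hf.continuous_fderiv one_ne_zero).clm_apply continuous_const
  have hder := hasDerivAt_comp_line hf u
  have hderc : ∀ y : E, Continuous fun z : ℝ => fderiv ℝ f (y + z • u) u := fun y =>
    hdc.comp (by fun_prop)
  have hs := hi.prod_right_ae
  have hs' := hi'.prod_right_ae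
  have hI : Integrable (fun p : E × ℝ => p.2 * f (p.1 + p.2 • u)) (ν.prod (gaussianReal 0 v)) := by
    rw [integrable_prod_iff (Continuous.aestronglyMeasurable (by fun_prop))]
    constructor
    · filter_upwards [hs, hs'] with y h1 h2
      exact (integrable_id_mul_gaussianReal hv (hder y) (hderc y) h1 h2).1
    -- Integrability on almost every fibre is not enough; the quantitative one-dimensional estimate
    -- bounds the fibre norms by a function integrable in `y`.
    · refine Integrable.mono'
        (g := fun y => (1 + v) * (∫ z, |f (y + z • u)| ∂gaussianReal 0 v + 1) +
          v * ∫ z, |fderiv ℝ f (y + z • u) u| ∂gaussianReal 0 v) ?_ ?_ ?_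
      · exact ((hi.integral_norm_prod_left.add (integrable_const 1)).const_mul _).add
          (hi'.integral_norm_prod_left.const_mul _)
      · exact (Continuous.aestronglyMeasurable (f := fun p : E × ℝ => p.2 * f (p.1 + p.2 • u))
          (by fun_prop)).norm.integral_prod_right'
      · filter_upwards [hs, hs'] with y h1 h2
        rw [Real.norm_of_nonneg (integral_nonneg fun _ => norm_nonneg _)]
        exact (integrable_id_mul_gaussianReal hv (hder y) (hderc y) h1 h2).2
  refine ⟨hI, ?_⟩
  rw [integral_prod _ hI, integral_prod _ hi', ← integral_const_mul]
  refine integral_congr_ae ?_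
  filter_upwards [hs, hs'] with y h1 h2
  exact integral_id_mul_gaussianReal hv (hder y) (hderc y) h1 h2

end SteinProd

/-! ### Stein's identity for Gaussian vectors -/

section SteinVector

variable {N : ℕ}

lemma partialDeriv_eq_fderiv {f : (Fin N → ℝ) → ℝ} {x : Fin N → ℝ}
    (hf : DifferentiableAt ℝ f x) (i : Fin N) :
    partialDeriv i f x = fderiv ℝ f x (Pi.single i 1) :=
  hf.lineDeriv_eq_fderiv

lemma fderiv_apply_eq_sum_partialDeriv {f : (Fin N → ℝ) → ℝ} {x : Fin N → ℝ}
    (hf : DifferentiableAt ℝ f x) (u : Fin N → ℝ) :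
    fderiv ℝ f x u = ∑ i, u i * partialDeriv i f x := by
  conv_lhs => rw [pi_eq_sum_univ' u]
  rw [map_sum]
  refine Finset.sum_congr rfl fun i _ => ?_
  rw [map_smul, partialDeriv_eq_fderiv hf, smul_eq_mul]

variable {Ω : Type*} [MeasurableSpace Ω] {P : Measure Ω} [IsProbabilityMeasure P]
  {X : Ω → (Fin N → ℝ)}

/-- The residual of a Gaussian vector after linear regression on one of its coordinates is
independent of that coordinate. -/
lemma indepFun_sub_regression (hX : HasGaussianLaw X P) (j : Fin N)
    (hj : Var[fun ω => X ω j; P] ≠ 0) :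
    IndepFun (fun ω => X ω - X ω j • fun i => cov[fun ω => X ω j, fun ω => X ω i; P] /
      Var[fun ω => X ω j; P]) (fun ω => X ω j) P := by
  set u : Fin N → ℝ := fun i => cov[fun ω => X ω j, fun ω => X ω i; P] /
    Var[fun ω => X ω j; P] with hu
  have hm : ∀ i, MemLp (fun ω => X ω i) 2 P := fun i => (hX.eval i).memLp_two
  -- Residual and coordinate are jointly Gaussian as a linear image of `X`, so zero covariance gives
  -- independence. The coordinate is made a `Unit`-indexed family to fit the covariance criterion.
  let L : (Fin N → ℝ) →L[ℝ] (Fin N → ℝ) × (Unit → ℝ) :=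
    ((ContinuousLinearMap.id ℝ (Fin N → ℝ)) -
      (ContinuousLinearMap.proj (R := ℝ) (φ := fun _ : Fin N => ℝ) j).smulRight u).prod
      (ContinuousLinearMap.pi fun _ => ContinuousLinearMap.proj (R := ℝ) (φ := fun _ : Fin N => ℝ) j)
  have hG : HasGaussianLaw (fun ω => ((fun i => (fun i ω => X ω i - X ω j * u i) i ω),
      (fun k : Unit => (fun (_ : Unit) ω => X ω j) k ω))) P := hX.map_fun L
  have h := hG.indepFun_of_covariance_eval (fun i _ => by
    rw [covariance_fun_sub_left (hm i) ((hm j).mul_const _) (hm j), covariance_mul_const_left,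
      covariance_self (hm j).aestronglyMeasurable.aemeasurable, hu,
      covariance_comm (fun ω => X ω i)]
    field_simp
    ring)
  exact h.comp (φ := id) (ψ := fun y : Unit → ℝ => y ()) measurable_id (by fun_prop)

/-- Stein's identity for a possibly degenerate Gaussian vector. -/
theorem stein_vector (hX : HasGaussianLaw X P) (j : Fin N) {f : (Fin N → ℝ) → ℝ}
    (hf : ContDiff ℝ 1 f) (hi : Integrable (fun ω => f (X ω)) P)
    (hi' : ∀ i, Integrable (fun ω => partialDeriv i f (X ω)) P) :
    Integrable (fun ω => X ω j * f (X ω)) P ∧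
      ∫ ω, X ω j * f (X ω) ∂P = (∫ ω, X ω j ∂P) * ∫ ω, f (X ω) ∂P +
        ∑ i, cov[fun ω => X ω j, fun ω => X ω i; P] * ∫ ω, partialDeriv i f (X ω) ∂P := by
  have hm : ∀ i, MemLp (fun ω => X ω i) 2 P := fun i => (hX.eval i).memLp_two
  set m := ∫ ω, X ω j ∂P with hmdef
  suffices H : Integrable (fun ω => (X ω j - m) * f (X ω)) P ∧
      ∫ ω, (X ω j - m) * f (X ω) ∂P =
        ∑ i, cov[fun ω => X ω j, fun ω => X ω i; P] * ∫ ω, partialDeriv i f (X ω) ∂P by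
    have e : (fun ω => X ω j * f (X ω)) = fun ω => m * f (X ω) + (X ω j - m) * f (X ω) := by
      ext ω; ring
    rw [e]
    refine ⟨(hi.const_mul m).add H.1, ?_⟩
    rw [integral_add (hi.const_mul m) H.1, H.2, integral_const_mul]
  by_cases hj : Var[fun ω => X ω j; P] = 0
  -- Degenerate case: `Xⱼ` is almost surely constant and both sides vanish.
  · have hae : (fun ω => X ω j) =ᵐ[P] fun _ => m := 
      ae_eq_integral_of_variance_eq_zero (hm j) hj
    have h0 : (fun ω => (X ω j - m) * f (X ω)) =ᵐ[P] fun _ => 0 := by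
      filter_upwards [hae] with ω hω
      simp [hω]
    refine ⟨(integrable_zero _ _ _).congr h0.symm, ?_⟩
    rw [integral_congr_ae h0]
    simp only [integral_zero]
    symm
    refine Finset.sum_eq_zero fun i _ => ?_
    have hc : cov[fun ω => X ω j, fun ω => X ω i; P] = 0 := by
      refine integral_eq_zero_of_ae ?_
      filter_upwards [hae] with ω hω
      simp [hω, ← hmdef]
    rw [hc, zero_mul]
  · set u : Fin N → ℝ := fun i => cov[fun ω => X ω j, fun ω => X ω i; P] /
      Var[fun ω => X ω j; P] with hu
    have hv : Var[fun ω => X ω j; P].toNNReal ≠ 0 := by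
      rw [Ne, Real.toNNReal_eq_zero, not_le]
      exact lt_of_le_of_ne (variance_nonneg _ _) (Ne.symm hj)
    have hvc : ((Var[fun ω => X ω j; P].toNNReal : ℝ≥0) : ℝ) = Var[fun ω => X ω j; P] :=
      Real.coe_toNNReal _ (variance_nonneg _ _)
    set v := Var[fun ω => X ω j; P].toNNReal
    have hXm : AEMeasurable X P := hX.aemeasurable
    -- Moving `m • u` into the residual centres the Gaussian coordinate and keeps `X = Y + Z • u`.
    have hind : IndepFun (fun ω => X ω - X ω j • u + m • u) (fun ω => X ω j - m) P :=
      (indepFun_sub_regression hX j hj).comp (φ := fun y => y + m • u) (ψ := fun z => z - m)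
        (by fun_prop) (by fun_prop)
    have hXj : AEMeasurable (fun ω => X ω j) P := (hX.eval j).aemeasurable
    have hYm : AEMeasurable (fun ω => X ω - X ω j • u + m • u) P := by fun_prop
    have hZm : AEMeasurable (fun ω => X ω j - m) P := by fun_prop
    have hZlaw : P.map (fun ω => X ω j - m) = gaussianReal 0 v := by
      have h1 : HasLaw (fun ω => X ω j) (gaussianReal m v) P :=
        ⟨hXj, (hX.eval j).map_eq_gaussianReal⟩
      have := (gaussianReal_sub_const h1 m).map_eq
      rwa [sub_self] at this
    have hlaw := (indepFun_iff_map_prod_eq_prod_map_map hYm hZm).1 hind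
    rw [hZlaw] at hlaw
    have hT : AEMeasurable (fun ω => (X ω - X ω j • u + m • u, X ω j - m)) P := hYm.prodMk hZm
    have hrec : ∀ ω, X ω - X ω j • u + m • u + (X ω j - m) • u = X ω := fun ω => by
      rw [sub_smul]; abel
    have hfd := hf.differentiable one_ne_zero
    have hdc : Continuous fun x => fderiv ℝ f x u :=
      (hf.continuous_fderiv one_ne_zero).clm_apply continuous_const
    have hfc := hf.continuous
    have hF : Continuous fun p : (Fin N → ℝ) × ℝ => f (p.1 + p.2 • u) := by fun_prop
    have hDF : Continuous fun p : (Fin N → ℝ) × ℝ => fderiv ℝ f (p.1 + p.2 • u) u :=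
      hdc.comp (by fun_prop)
    have hZF : Continuous fun p : (Fin N → ℝ) × ℝ => p.2 * f (p.1 + p.2 • u) := by fun_prop
    have hmeas : ∀ F : (Fin N → ℝ) × ℝ → ℝ, Continuous F → AEStronglyMeasurable F
      (P.map (fun ω => (X ω - X ω j • u + m • u, X ω j - m))) := fun F h => h.aestronglyMeasurable
    have hsum : ∀ ω, fderiv ℝ f (X ω) u = ∑ i, u i * partialDeriv i f (X ω) := fun ω =>
      fderiv_apply_eq_sum_partialDeriv (hfd _) u
    have hDi : Integrable (fun ω => fderiv ℝ f (X ω) u) P := by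
      simp only [hsum]
      exact integrable_finsetSum _ fun i _ => (hi' i).const_mul _
    have hS := stein_prod hv (P.map (fun ω => X ω - X ω j • u + m • u)) u hf
      (by
        rw [← hlaw, integrable_map_measure (hmeas _ hF) hT]
        simpa only [Function.comp_def, hrec] using hi)
      (by
        rw [← hlaw, integrable_map_measure (hmeas _ hDF) hT]
        simpa only [Function.comp_def, hrec] using hDi)
    rw [← hlaw, integrable_map_measure (hmeas _ hZF) hT, integral_map hT (hmeas _ hZF),
      integral_map hT (hmeas _ hDF)] at hS
    simp only [Function.comp_def, hrec] at hS
    refine ⟨hS.1, hS.2.trans ?_⟩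
    simp only [hsum]
    rw [integral_finsetSum _ fun i _ => (hi' i).const_mul _, Finset.mul_sum]
    refine Finset.sum_congr rfl fun i _ => ?_
    rw [integral_const_mul, hvc, hu]
    field_simp

end SteinVector

/-! ### Calculus of mixed partial derivatives -/

section MixedPartial

variable {N : ℕ} {g : (Fin N → ℝ) → ℝ}

lemma partialDeriv_eq_fderiv_fun (hg : Differentiable ℝ g) (i : Fin N) :
    partialDeriv i g = fun x => fderiv ℝ g x (Pi.single i 1) :=
  funext fun x => partialDeriv_eq_fderiv (hg x) i

lemma contDiff_partialDeriv {m : ℕ} (hg : ContDiff ℝ (m + 1 : ℕ) g) (i : Fin N) :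
    ContDiff ℝ m (partialDeriv i g) := by
  rw [partialDeriv_eq_fderiv_fun (hg.differentiable (by simp))]
  exact (hg.fderiv_right (m := m) (by norm_cast)).clm_apply contDiff_const

lemma partialDeriv_comm (hg : ContDiff ℝ 2 g) (i j : Fin N) :
    partialDeriv i (partialDeriv j g) = partialDeriv j (partialDeriv i g) := by
  have hd : Differentiable ℝ (fderiv ℝ g) :=
    (hg.fderiv_right (m := 1) (by norm_num)).differentiable one_ne_zero
  have key : ∀ i j : Fin N, ∀ x, partialDeriv i (partialDeriv j g) x =
      fderiv ℝ (fderiv ℝ g) x (Pi.single i 1) (Pi.single j 1) := by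
    intro i j x
    rw [partialDeriv_eq_fderiv_fun (hg.differentiable two_ne_zero) j, partialDeriv_eq_fderiv]
    · rw [fderiv_clm_apply (hd x) (by fun_prop)]
      simp
    · exact (hd x).clm_apply (by fun_prop)
  ext x
  rw [key, key]
  exact (hg.contDiffAt.isSymmSndFDerivAt (by simp)) _ _

lemma contDiff_iterate_partialDeriv {m : ℕ} (i : Fin N) (k : ℕ) {g : (Fin N → ℝ) → ℝ}
    (hg : ContDiff ℝ (m + k : ℕ) g) : ContDiff ℝ m ((partialDeriv i)^[k] g) := by
  induction k generalizing g with
  | zero => simpa using hg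
  | succ k ih => exact ih (contDiff_partialDeriv (by rwa [add_assoc]) i)

lemma iterate_partialDeriv_comm (i j : Fin N) (k : ℕ) {g : (Fin N → ℝ) → ℝ}
    (hg : ContDiff ℝ (k + 1 : ℕ) g) :
    (partialDeriv j)^[k] (partialDeriv i g) = partialDeriv i ((partialDeriv j)^[k] g) := by
  induction k generalizing g with
  | zero => rfl
  | succ k ih =>
    rw [Function.iterate_succ_apply, Function.iterate_succ_apply, partialDeriv_comm
      (hg.of_le (by norm_cast; omega)), ih (contDiff_partialDeriv hg j)]

lemma contDiff_foldr_partialDeriv {m : ℕ} (a : Fin N → ℕ) (L : List (Fin N))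
    (hg : ContDiff ℝ (m + (L.map a).sum : ℕ) g) :
    ContDiff ℝ m (L.foldr (fun i f => (partialDeriv i)^[a i] f) g) := by
  induction L generalizing m with
  | nil => simpa using hg
  | cons j L ih =>
    rw [List.foldr_cons]
    refine contDiff_iterate_partialDeriv _ _ (ih ?_)
    simpa [add_assoc] using hg

/-- The extra `∂ᵢ` enters at the position of `i` and commutes outward past the earlier coordinates.
The case `i ∉ L` is there for the induction on the list. -/
lemma foldr_partialDeriv_add_single (a : Fin N → ℕ) (i : Fin N) (L : List (Fin N))
    (hL : L.Nodup) (hg : ContDiff ℝ ((L.map a).sum + 1 : ℕ) g) :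
    L.foldr (fun k f => (partialDeriv k)^[(a + Pi.single i 1 : Fin N → ℕ) k] f) g =
      if i ∈ L then partialDeriv i (L.foldr (fun k f => (partialDeriv k)^[a k] f) g)
      else L.foldr (fun k f => (partialDeriv k)^[a k] f) g := by
  induction L with
  | nil => simp
  | cons j L ih =>
    rw [List.nodup_cons] at hL
    have hg' : ContDiff ℝ ((L.map a).sum + 1 : ℕ) g := hg.of_le (by
      norm_cast; simp)
    rw [List.foldr_cons, List.foldr_cons, ih hL.2 hg']
    by_cases hij : i = j
    · subst hij
      rw [if_neg hL.1, if_pos (by simp)]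
      simp [Function.iterate_succ_apply']
    · have hji : (a + Pi.single i 1 : Fin N → ℕ) j = a j := by
        simp [Ne.symm hij]
      rw [hji]
      by_cases hi : i ∈ L
      · rw [if_pos hi, if_pos (by simp [hi]), iterate_partialDeriv_comm]
        refine contDiff_foldr_partialDeriv a L (hg.of_le ?_)
        norm_cast
        simp only [List.map_cons, List.sum_cons]; omega
      · rw [if_neg hi, if_neg (by simp [hi, hij])]

lemma sum_map_finRange (a : Fin N → ℕ) : ((List.finRange N).map a).sum = ∑ i, a i := by
  rw [Fin.sum_univ_def]

lemma contDiff_mixedPartial {m : ℕ} (a : Fin N → ℕ)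
    (hg : ContDiff ℝ (m + ∑ i, a i : ℕ) g) : ContDiff ℝ m (mixedPartial a g) :=
  contDiff_foldr_partialDeriv a _ (by rwa [sum_map_finRange])

lemma mixedPartial_zero : mixedPartial 0 g = g := by
  have : ∀ L : List (Fin N), L.foldr (fun k f => (partialDeriv k)^[(0 : Fin N → ℕ) k] f) g = g := by
    intro L
    induction L with
    | nil => rfl
    | cons j L ih => rw [List.foldr_cons, ih]; rfl
  exact this _

lemma mixedPartial_add_single (a : Fin N → ℕ) (i : Fin N)
    (hg : ContDiff ℝ (∑ i, a i + 1 : ℕ) g) :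
    mixedPartial (a + Pi.single i 1) g = partialDeriv i (mixedPartial a g) := by
  have := foldr_partialDeriv_add_single a i (List.finRange N) (List.nodup_finRange N)
    (g := g) (by rwa [sum_map_finRange])
  rw [if_pos (List.mem_finRange i)] at this
  exact this

lemma partialDeriv_monomial_mul {F : (Fin N → ℝ) → ℝ} (hF : Differentiable ℝ F)
    (b : Fin N → ℕ) (i : Fin N) (x : Fin N → ℝ) :
    partialDeriv i (fun x => (∏ k, x k ^ b k) * F x) x =
      b i * ((∏ k, x k ^ (b - Pi.single i 1 : Fin N → ℕ) k) * F x) +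
        (∏ k, x k ^ b k) * partialDeriv i F x := by
  have hsplit : ∀ (y : Fin N → ℝ) (c : Fin N → ℕ), ∏ k, y k ^ c k =
      y i ^ c i * ∏ k ∈ Finset.univ.erase i, y k ^ c k := fun y c =>
    (Finset.mul_prod_erase _ _ (Finset.mem_univ i)).symm
  have hmono : HasLineDerivAt ℝ (fun x : Fin N → ℝ => ∏ k, x k ^ b k)
      (b i * ∏ k, x k ^ (b - Pi.single i 1 : Fin N → ℕ) k) x (Pi.single i 1) := by
    have h1 : HasDerivAt (fun t : ℝ => (x i + t) ^ b i * ∏ k ∈ Finset.univ.erase i, x k ^ b k)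
        (b i * x i ^ (b i - 1) * ∏ k ∈ Finset.univ.erase i, x k ^ b k) 0 := by
      have := (((hasDerivAt_id (0 : ℝ)).const_add (x i)).pow (b i)).mul_const
        (∏ k ∈ Finset.univ.erase i, x k ^ b k)
      simpa using this
    refine (h1.congr_deriv ?_).congr_of_eventuallyEq (Filter.Eventually.of_forall fun t => ?_)
    · rw [hsplit x (b - Pi.single i 1)]
      simp only [Pi.sub_apply, Pi.single_eq_same, mul_assoc]
      congr 2
      refine Finset.prod_congr rfl fun k hk => ?_
      simp [(Finset.mem_erase.1 hk).1]
    · dsimp only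
      rw [hsplit (x + t • Pi.single i 1) b]
      congr 1
      · simp
      · refine Finset.prod_congr rfl fun k hk => ?_
        simp [(Finset.mem_erase.1 hk).1]
  have hFd : HasLineDerivAt ℝ F (partialDeriv i F x) x (Pi.single i 1) :=
    (hF x).lineDifferentiableAt.hasLineDerivAt
  have := HasDerivAt.mul hmono hFd
  have h2 : HasLineDerivAt ℝ (fun x => (∏ k, x k ^ b k) * F x)
      (b i * ((∏ k, x k ^ (b - Pi.single i 1 : Fin N → ℕ) k) * F x) +
        (∏ k, x k ^ b k) * partialDeriv i F x)
      x (Pi.single i 1) := this.congr_deriv (by simp; ring)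
  exact h2.lineDeriv

end MixedPartial

/-! ### Integrability of monomials times derivatives -/

section Moments

variable {N : ℕ} {Ω : Type*} [MeasurableSpace Ω] {P : Measure Ω}
  {X : Ω → (Fin N → ℝ)} {g : (Fin N → ℝ) → ℝ} {K : ℕ}

/-- Stein's identity applied to a monomial times a mixed partial derivative. -/
lemma stein_monomial [IsProbabilityMeasure P] (hX : HasGaussianLaw X P) (hg : ContDiff ℝ K g)
    (b a : Fin N → ℕ) (hK : ∑ i, a i + 1 ≤ K) (j : Fin N)
    (h0 : Integrable (fun ω => (∏ k, X ω k ^ b k) * mixedPartial a g (X ω)) P)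
    (h1 : ∀ i, b i ≠ 0 →
      Integrable (fun ω => (∏ k, X ω k ^ (b - Pi.single i 1 : Fin N → ℕ) k) *
        mixedPartial a g (X ω)) P)
    (h2 : ∀ i, Integrable
      (fun ω => (∏ k, X ω k ^ b k) * mixedPartial (a + Pi.single i 1) g (X ω)) P) :
    Integrable (fun ω => (∏ k, X ω k ^ (b + Pi.single j 1 : Fin N → ℕ) k) *
        mixedPartial a g (X ω)) P ∧
      ∫ ω, (∏ k, X ω k ^ (b + Pi.single j 1 : Fin N → ℕ) k) * mixedPartial a g (X ω) ∂P =
        (∫ ω, X ω j ∂P) * ∫ ω, (∏ k, X ω k ^ b k) * mixedPartial a g (X ω) ∂P +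
        ∑ i, cov[fun ω => X ω j, fun ω => X ω i; P] *
          (b i * ∫ ω, (∏ k, X ω k ^ (b - Pi.single i 1 : Fin N → ℕ) k) * mixedPartial a g (X ω) ∂P +
            ∫ ω, (∏ k, X ω k ^ b k) * mixedPartial (a + Pi.single i 1) g (X ω) ∂P) := by
  have hF : ContDiff ℝ 1 (mixedPartial a g) := by
    have := contDiff_mixedPartial (m := 1) (g := g) a (hg.of_le (by norm_cast; omega))
    exact_mod_cast this
  have hf : ContDiff ℝ 1 fun x : Fin N → ℝ => (∏ k, x k ^ b k) * mixedPartial a g x :=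
    (contDiff_prod fun k _ => (contDiff_apply ℝ ℝ k).pow _).mul hF
  have hpd : ∀ i ω, partialDeriv i (fun x => (∏ k, x k ^ b k) * mixedPartial a g x) (X ω) =
      b i * ((∏ k, X ω k ^ (b - Pi.single i 1 : Fin N → ℕ) k) * mixedPartial a g (X ω)) +
      (∏ k, X ω k ^ b k) * mixedPartial (a + Pi.single i 1) g (X ω) := fun i ω => by
    rw [partialDeriv_monomial_mul (hF.differentiable one_ne_zero), mixedPartial_add_single]
    exact hg.of_le (by norm_cast)
  have h1' : ∀ i, Integrable
      (fun ω => b i * ((∏ k, X ω k ^ (b - Pi.single i 1 : Fin N → ℕ) k) * mixedPartial a g (X ω))) P := by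
    intro i
    by_cases hb : b i = 0
    · simp [hb]
    · exact (h1 i hb).const_mul _
  have hS := stein_vector hX j hf h0 (fun i => by
    simp only [hpd]
    exact (h1' i).add (h2 i))
  have e : (fun ω => (∏ k, X ω k ^ (b + Pi.single j 1 : Fin N → ℕ) k) * mixedPartial a g (X ω)) =
      fun ω => X ω j * ((∏ k, X ω k ^ b k) * mixedPartial a g (X ω)) := by
    ext ω
    simp only [Pi.add_apply, pow_add, Finset.prod_mul_distrib]
    have : ∏ k, X ω k ^ (Pi.single j 1 : Fin N → ℕ) k = X ω j := by
      rw [Finset.prod_eq_single j]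
      · simp
      · intro k _ hk; simp [hk]
      · simp
    rw [this]; ring
  rw [e]
  refine ⟨hS.1, hS.2.trans ?_⟩
  congr 1
  refine Finset.sum_congr rfl fun i _ => ?_
  simp only [hpd]
  rw [integral_add (h1' i) (h2 i), integral_const_mul]

lemma sum_add_single (a : Fin N → ℕ) (i : Fin N) :
    ∑ k, (a + Pi.single i 1 : Fin N → ℕ) k = ∑ k, a k + 1 := by
  simp [Finset.sum_add_distrib]

lemma sub_single_add_single {b : Fin N → ℕ} {i : Fin N} (hi : b i ≠ 0) :
    b - Pi.single i 1 + Pi.single i 1 = b := by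
  ext k
  by_cases h : k = i
  · subst h; simp; omega
  · simp [h]

lemma sum_sub_single {b : Fin N → ℕ} {i : Fin N} (hi : b i ≠ 0) :
    ∑ k, (b - Pi.single i 1 : Fin N → ℕ) k + 1 = ∑ k, b k := by
  rw [← sum_add_single, sub_single_add_single hi]

/-- Induction on `|b|`: Stein's identity adds a factor `Xⱼ`, and every term it requires has a
monomial of smaller degree, with `|b| + |a|` not increased. -/
lemma integrable_monomial_mul_mixedPartial [IsProbabilityMeasure P] (hX : HasGaussianLaw X P) (hg : ContDiff ℝ K g)
    (hint : ∀ a : Fin N → ℕ, ∑ i, a i ≤ K → Integrable (fun ω => mixedPartial a g (X ω)) P) :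
    ∀ (b a : Fin N → ℕ), ∑ i, b i + ∑ i, a i ≤ K →
      Integrable (fun ω => (∏ k, X ω k ^ b k) * mixedPartial a g (X ω)) P := by
  suffices H : ∀ s : ℕ, ∀ (b a : Fin N → ℕ), ∑ i, b i ≤ s → ∑ i, b i + ∑ i, a i ≤ K →
      Integrable (fun ω => (∏ k, X ω k ^ b k) * mixedPartial a g (X ω)) P from
    fun b a => H _ b a le_rfl
  intro s
  induction s with
  | zero =>
    intro b a hb ha
    have : ∀ i, b i = 0 := by simpa using hb
    simp only [this, pow_zero, Finset.prod_const_one, one_mul]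
    exact hint a (by omega)
  | succ s ih =>
    intro b a hb ha
    by_cases h : ∃ j, b j ≠ 0
    · obtain ⟨j, hj⟩ := h
      have hs := sum_sub_single hj
      rw [← sub_single_add_single hj]
      refine (stein_monomial hX hg _ a (by omega) j (ih _ _ (by omega) (by omega))
        (fun i hi => ?_) (fun i => ih _ _ (by omega) ?_)).1
      · have := sum_sub_single hi
        exact ih _ _ (by omega) (by omega)
      · rw [sum_add_single]; omega
    · push Not at h
      exact ih b a (by simp [h]) ha

/-- A nonnegative integer matrix with prescribed column sums and bounded row sums exists as soon
as the totals allow it. -/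
lemma exists_matrix_of_sum_le (n : Fin N → ℕ) (s : ℕ) (a : Fin N → ℕ) (hs : ∑ i, a i = s)
    (ha : ∑ i, a i ≤ ∑ i, n i) :
    ∃ l : Fin N → Fin N → ℕ, (∀ i, ∑ j, l i j ≤ n i) ∧ ∀ j, ∑ i, l i j = a j := by
  induction s generalizing a with
  | zero =>
    refine ⟨0, by simp, fun j => ?_⟩
    have : ∀ i, a i = 0 := by simpa using hs
    simp [this]
  | succ s ih =>
    have h : ∃ j, a j ≠ 0 := by
      by_contra! h
      simp [h] at hs
    obtain ⟨j, hj⟩ := h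
    have hsub := sum_sub_single hj
    obtain ⟨l, hl, hc⟩ := ih (a - Pi.single j 1) (by omega) (by omega)
    have htot : ∑ i, ∑ k, l i k = s := by
      rw [Finset.sum_comm]
      simp only [hc]; omega
    -- The entries found so far total `s < ∑ n`, so some row has room for one more unit in column
    -- `j`.
    obtain ⟨i, hi⟩ : ∃ i, ∑ k, l i k < n i := by
      by_contra! h
      have := Finset.sum_le_sum fun i (_ : i ∈ Finset.univ) => h i
      omega
    refine ⟨l + Pi.single i (Pi.single j 1), fun i' => ?_, fun j' => ?_⟩
    · by_cases h : i' = i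
      · subst h
        simp [Finset.sum_add_distrib]; omega
      · simpa [Pi.single_apply, h] using hl i'
    · have : ∑ x, (Pi.single i (Pi.single j 1) : Fin N → Fin N → ℕ) x j' =
          (Pi.single j 1 : Fin N → ℕ) j' := by
        rw [Finset.sum_eq_single i]
        · simp
        · intro k _ hk; simp [hk]
        · simp
      simp only [Pi.add_apply, Finset.sum_add_distrib, this, hc]
      exact congrFun (sub_single_add_single hj) j'

/-- For `k = 0` the derivative orders are the column sums of `ℓ`, which can be any `a` with `|a| ≤
|n|`; the slack in the rows goes into `r`. So every such order already occurs in the formula. -/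
lemma integrable_mixedPartial_of_le (n : Fin N → ℕ)
    (hint' : ∀ p ∈ decompositions n, ∀ k ∈ pairings p.2,
      Integrable (fun ω => mixedPartial (derivOrder p.2 k) g (X ω)) P)
    (a : Fin N → ℕ) (ha : ∑ i, a i ≤ ∑ i, n i) :
    Integrable (fun ω => mixedPartial a g (X ω)) P := by
  obtain ⟨l, hl, hc⟩ := exists_matrix_of_sum_le n _ a rfl ha
  have hle : ∀ i j, l i j ≤ n i := fun i j =>
    (Finset.single_le_sum (f := l i) (fun _ _ => Nat.zero_le _) (Finset.mem_univ j)).trans (hl i)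
  have := hint' (fun i => n i - ∑ j, l i j, l) (by
      simp only [decompositions, Finset.mem_filter, Finset.mem_product, Fintype.mem_piFinset,
        Finset.mem_range]
      refine ⟨⟨fun i => by omega, fun i j => by have := hle i j; omega⟩, fun i => ?_⟩
      have := hl i; omega) 0 (by simp [pairings])
  have e : derivOrder l 0 = a := by
    ext i; simp [derivOrder, hc]
  rwa [e] at this

end Moments

open scoped Nat

/-! ### Coefficients of a multivariate exponential -/

section ExponentialSum

variable {N : ℕ} {I : Type*} [Fintype I] {R : Type*} [CommRing R] [Algebra ℝ R]

lemma le_sum_of_sum_smul_eq {d : I → Fin N → ℕ} (hd : ∀ α, d α ≠ 0) {m : I → ℕ} {n : Fin N → ℕ}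
    (h : ∑ α, m α • d α = n) (α : I) : m α ≤ ∑ i, n i := by
  obtain ⟨i, hi⟩ := Function.ne_iff.1 (hd α)
  calc m α ≤ m α * d α i := Nat.le_mul_of_pos_right _ (Nat.pos_of_ne_zero hi)
    _ ≤ ∑ β, m β * d β i :=
        Finset.single_le_sum (f := fun β => m β * d β i) (fun _ _ => Nat.zero_le _)
          (Finset.mem_univ α)
    _ = n i := by rw [← h]; simp
    _ ≤ ∑ i, n i := Finset.single_le_sum (f := n) (fun _ _ => Nat.zero_le _) (Finset.mem_univ i)

variable [DecidableEq I]

/-- The multiplicity functions `m` with `∑ α, m α • d α = n`. -/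
def weightedMultiplicities (d : I → Fin N → ℕ) (n : Fin N → ℕ) : Finset (I → ℕ) :=
  (Fintype.piFinset fun _ => Finset.range (∑ i, n i + 1)).filter fun m => ∑ α, m α • d α = n

/-- The product of divided powers `∏ α, c α ^ m α / (m α)!`. -/
noncomputable def dividedMonomial (c : I → R) (m : I → ℕ) : R :=
  ∏ α, ((m α)! : ℝ)⁻¹ • c α ^ m α

/-- The coefficient of `t ^ n` in `exp (∑ α, c α * t ^ d α)`. -/
noncomputable def exponentialCoeff (d : I → Fin N → ℕ) (c : I → R) (n : Fin N → ℕ) : R :=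
  ∑ m ∈ weightedMultiplicities d n, dividedMonomial c m

variable {d : I → Fin N → ℕ} {c : I → R}

lemma mem_weightedMultiplicities (hd : ∀ α, d α ≠ 0) {m : I → ℕ} {n : Fin N → ℕ} :
    m ∈ weightedMultiplicities d n ↔ ∑ α, m α • d α = n := by
  simp only [weightedMultiplicities, Finset.mem_filter, Fintype.mem_piFinset, Finset.mem_range,
    and_iff_right_iff_imp]
  exact fun h α => Nat.lt_succ_of_le (le_sum_of_sum_smul_eq hd h α)

lemma exponentialCoeff_zero (hd : ∀ α, d α ≠ 0) : exponentialCoeff d c 0 = 1 := by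
  have : weightedMultiplicities d 0 = {0} := by
    ext m
    rw [mem_weightedMultiplicities hd, Finset.mem_singleton]
    constructor
    · intro h
      ext α
      simpa using le_sum_of_sum_smul_eq hd h α
    · rintro rfl
      simp
  simp [exponentialCoeff, this, dividedMonomial]

lemma dividedMonomial_add_single (m : I → ℕ) (α : I) :
    ((m α + 1 : ℕ) : ℝ) • dividedMonomial c (m + Pi.single α 1) = c α * dividedMonomial c m := by
  unfold dividedMonomial
  rw [← Finset.mul_prod_erase _ _ (Finset.mem_univ α),
    ← Finset.mul_prod_erase _ (fun β => ((m β)! : ℝ)⁻¹ • c β ^ m β) (Finset.mem_univ α)]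
  have h1 : ∏ x ∈ Finset.univ.erase α, (((m + Pi.single α 1 : I → ℕ) x)! : ℝ)⁻¹ •
      c x ^ (m + Pi.single α 1 : I → ℕ) x =
      ∏ x ∈ Finset.univ.erase α, ((m x)! : ℝ)⁻¹ • c x ^ m x := by
    refine Finset.prod_congr rfl fun k hk => ?_
    simp [(Finset.mem_erase.1 hk).1]
  rw [h1]
  have h2 : ((m α + 1 : ℕ) : ℝ) * (((m α + 1)! : ℕ) : ℝ)⁻¹ = ((m α)! : ℝ)⁻¹ := by
    rw [Nat.factorial_succ]
    have : ((m α)! : ℝ) ≠ 0 := by positivity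
    push_cast
    field_simp
  simp only [Pi.add_apply, Pi.single_eq_same]
  rw [← smul_mul_assoc, smul_smul, h2, pow_succ', ← mul_assoc, mul_smul_comm]

lemma sum_add_single_smul (m : I → ℕ) (α : I) :
    ∑ β, (m + Pi.single α 1 : I → ℕ) β • d β = ∑ β, m β • d β + d α := by
  simp only [Pi.add_apply, add_smul, Finset.sum_add_distrib]
  congr 1
  rw [Finset.sum_eq_single α]
  · simp
  · intro β _ hβ; simp [hβ]
  · simp

open scoped Classical in
-- Adding one copy of `α` maps the multiplicities of degree `n - d α` bijectively onto those of
-- degree `n` that use `α`; the factor `m α` lowers the factorial.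
lemma sum_smul_dividedMonomial (hd : ∀ α, d α ≠ 0) (n : Fin N → ℕ) (α : I) :
    ∑ m ∈ weightedMultiplicities d n, (m α : ℝ) • dividedMonomial c m =
      if d α ≤ n then c α * exponentialCoeff d c (n - d α) else 0 := by
  have key : ∀ m ∈ weightedMultiplicities d n, m α ≠ 0 →
      ∃ m' : I → ℕ, m = m' + Pi.single α 1 ∧ ∑ β, m' β • d β + d α = n := by
    intro m hm hα
    have hs : m - Pi.single α 1 + Pi.single α 1 = m := by
      ext β
      by_cases h : β = α
      · subst h; simp; omega
      · simp [h]
    refine ⟨m - Pi.single α 1, hs.symm, ?_⟩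
    rw [← sum_add_single_smul, hs]
    exact (mem_weightedMultiplicities hd).1 hm
  split_ifs with hle
  · rw [exponentialCoeff, Finset.mul_sum]
    symm
    refine Finset.sum_of_injOn (fun m => m + Pi.single α 1) ?_ ?_ ?_ ?_
    · intro m _ m' _ h
      exact add_right_cancel h
    · intro m hm
      rw [Finset.mem_coe, mem_weightedMultiplicities hd] at hm ⊢
      rw [sum_add_single_smul, hm]
      exact tsub_add_cancel_of_le hle
    · intro m hm hni
      by_cases hα : m α = 0
      · simp [hα]
      · obtain ⟨m', rfl, hm'⟩ := key m hm hα
        refine absurd ⟨m', ?_, rfl⟩ hni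
        rw [Finset.mem_coe, mem_weightedMultiplicities hd, ← hm', add_tsub_cancel_right]
    · intro m _
      rw [← dividedMonomial_add_single]
      simp
  · refine Finset.sum_eq_zero fun m hm => ?_
    by_cases hα : m α = 0
    · simp [hα]
    · obtain ⟨m', rfl, hm'⟩ := key m hm hα
      exact absurd (hm' ▸ le_add_self) hle

open scoped Classical in
/-- Euler's recursion for the coefficients of an exponential. -/
theorem smul_exponentialCoeff (hd : ∀ α, d α ≠ 0) (n : Fin N → ℕ) (j : Fin N) :
    (n j : ℝ) • exponentialCoeff d c n =
      ∑ α, (d α j : ℝ) • (if d α ≤ n then c α * exponentialCoeff d c (n - d α) else 0) := by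
  simp only [← sum_smul_dividedMonomial hd, Finset.smul_sum]
  rw [Finset.sum_comm, exponentialCoeff, Finset.smul_sum]
  refine Finset.sum_congr rfl fun m hm => ?_
  rw [mem_weightedMultiplicities hd] at hm
  simp only [smul_smul]
  rw [← Finset.sum_smul]
  congr 1
  rw [← hm]
  simp only [Finset.sum_apply, Pi.smul_apply, smul_eq_mul, Nat.cast_sum, Nat.cast_mul]
  exact Finset.sum_congr rfl fun _ _ => mul_comm _ _

end ExponentialSum

/-! ### Building blocks of the Gaussian exponential -/

section GaussianIndices

variable {N : ℕ}

/-- The building blocks of the Gaussian moment formula: a factor `Xᵢ` is replaced by its mean,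
or turned into a derivative in direction `j`, or paired with another factor. -/
abbrev BlockIndex (N : ℕ) : Type := Fin N ⊕ (Fin N × Fin N) ⊕ Sym2 (Fin N)

/-- The multidegree of the pair `s(i, j)`. -/
def pairDegree (s : Sym2 (Fin N)) : Fin N → ℕ :=
  Sym2.lift ⟨fun i j => Pi.single i 1 + Pi.single j 1, fun _ _ => add_comm _ _⟩ s

/-- The weight of the pair `s(i, j)`: for symmetric `C` it is `C i j` if `i ≠ j` and `C i i / 2`
otherwise. -/
noncomputable def pairWeight (C : Matrix (Fin N) (Fin N) ℝ) (s : Sym2 (Fin N)) : ℝ :=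
  Sym2.lift ⟨fun i j => (C i j + C j i) / (if i = j then 4 else 2), fun i j => by
    simp only [add_comm (C i j), eq_comm (a := i)]⟩ s

/-- The multidegree, in the factors `Xᵢ`, of a building block. -/
def blockDegree : BlockIndex N → Fin N → ℕ
  | .inl i => Pi.single i 1
  | .inr (.inl p) => Pi.single p.1 1
  | .inr (.inr s) => pairDegree s

/-- The weight of a building block, a polynomial in the partial derivatives. -/
noncomputable def blockWeight (μ : Fin N → ℝ) (C : Matrix (Fin N) (Fin N) ℝ) :
    BlockIndex N → MvPolynomial (Fin N) ℝ
  | .inl i => MvPolynomial.C (μ i)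
  | .inr (.inl p) => MvPolynomial.C (C p.1 p.2) * MvPolynomial.X p.2
  | .inr (.inr s) => MvPolynomial.C (pairWeight C s)

lemma pairDegree_mk (i j : Fin N) : pairDegree s(i, j) = Pi.single i 1 + Pi.single j 1 := rfl

lemma blockDegree_ne_zero (α : BlockIndex N) : blockDegree α ≠ 0 := by
  rcases α with i | p | s
  · simp [blockDegree]
  · simp [blockDegree]
  · induction s using Sym2.ind with
    | _ i j =>
      intro h
      have := congrFun h i
      simp [blockDegree, pairDegree_mk] at this

lemma single_le_iff {n : Fin N → ℕ} {i : Fin N} :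
    (Pi.single i 1 : Fin N → ℕ) ≤ n ↔ n i ≠ 0 := by
  constructor
  · intro h
    have := h i
    simp at this
    omega
  · intro h k
    by_cases hk : k = i
    · subst hk; simp; omega
    · simp [hk]

lemma sum_sym2_eq_sum_mk {M : Type*} [AddCommMonoid M] (j : Fin N)
    (F : Sym2 (Fin N) → M) (hF : ∀ s, pairDegree s j = 0 → F s = 0) :
    ∑ s, F s = ∑ i, F s(i, j) := by
  symm
  refine Finset.sum_of_injOn (fun i => s(i, j)) ?_ (by simp) ?_ (fun _ _ => rfl)
  · intro i _ i' _ h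
    exact Sym2.congr_left.1 h
  · intro s _ hs
    apply hF
    induction s using Sym2.ind with
    | _ i k =>
      have h1 : i ≠ j := fun h => hs ⟨k, by simp, by rw [h]; exact Sym2.eq_swap⟩
      have h2 : k ≠ j := fun h => hs ⟨i, by simp, by rw [h]⟩
      simp [pairDegree_mk, h1.symm, h2.symm]

/-- The degree `2` of a diagonal pair cancels the `1/2` in its weight, so the recursion needs no
case distinction. -/
lemma pairDegree_mul_pairWeight {C : Matrix (Fin N) (Fin N) ℝ} (hC : ∀ i j, C i j = C j i)
    (i j : Fin N) : (pairDegree s(i, j) j : ℝ) * pairWeight C s(i, j) = C j i := by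
  simp only [pairWeight, Sym2.lift_mk, pairDegree_mk, hC i j]
  by_cases h : i = j
  · subst h; simp; ring
  · simp [h, Ne.symm h]

/-- The recursion satisfied by the coefficients of `exp (t·μ + t·C·t / 2 + t·C·D)`. -/
lemma smul_exponentialCoeff_block (μ : Fin N → ℝ) {C : Matrix (Fin N) (Fin N) ℝ}
    (hC : ∀ i j, C i j = C j i) (n : Fin N → ℕ) (j : Fin N) :
    ((n j + 1 : ℕ) : ℝ) •
        exponentialCoeff blockDegree (blockWeight μ C) (n + Pi.single j 1) =
      μ j • exponentialCoeff blockDegree (blockWeight μ C) n +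
      ∑ i, C j i • (MvPolynomial.X i * exponentialCoeff blockDegree (blockWeight μ C) n) +
      ∑ i, C j i • (if n i ≠ 0 then
        exponentialCoeff blockDegree (blockWeight μ C) (n - Pi.single i 1) else 0) := by
  classical
  set W := exponentialCoeff blockDegree (blockWeight μ C) with hW
  have h := smul_exponentialCoeff (c := blockWeight μ C) blockDegree_ne_zero
    (n + Pi.single j 1) j
  have e : (n + Pi.single j 1 : Fin N → ℕ) j = n j + 1 := by simp
  rw [e] at h
  rw [h, Fintype.sum_sum_type, Fintype.sum_sum_type, ← add_assoc]
  simp only [← hW]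
  have hle : (Pi.single j 1 : Fin N → ℕ) ≤ n + Pi.single j 1 := le_add_self
  congr 1
  · congr 1
    · rw [Finset.sum_eq_single j]
      · simp [blockDegree, blockWeight, hle, MvPolynomial.smul_eq_C_mul]
      · intro i _ hi
        simp [blockDegree, Ne.symm hi]
      · simp
    · rw [Fintype.sum_prod_type, Finset.sum_eq_single j]
      · refine Finset.sum_congr rfl fun i _ => ?_
        simp [blockDegree, blockWeight, hle, MvPolynomial.smul_eq_C_mul, mul_assoc]
      · intro i _ hi
        simp [blockDegree, Ne.symm hi]
      · simp
  · refine (sum_sym2_eq_sum_mk j (fun s => (pairDegree s j : ℝ) •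
      if pairDegree s ≤ n + Pi.single j 1 then
        MvPolynomial.C (pairWeight C s) * W (n + Pi.single j 1 - pairDegree s) else 0)
      (fun s hs => by simp [hs])).trans ?_
    refine Finset.sum_congr rfl fun i _ => ?_
    -- One end of the pair consumes the added `Xⱼ`; the other needs a factor `Xᵢ` from `n`.
    have h1 : pairDegree s(i, j) ≤ n + Pi.single j 1 ↔ n i ≠ 0 := by
      rw [pairDegree_mk, add_le_add_iff_right, single_le_iff]
    have h2 : n + Pi.single j 1 - pairDegree s(i, j) = n - Pi.single i 1 := by
      rw [pairDegree_mk, add_tsub_add_eq_tsub_right]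
    simp only [h1, h2, ← pairDegree_mul_pairWeight hC i j]
    split_ifs
    · rw [mul_smul, MvPolynomial.smul_eq_C_mul _ (pairWeight C _)]
    · simp

end GaussianIndices

/-! ### Moments as coefficients of the exponential -/

section MomentFormula

variable {N : ℕ} {Ω : Type*} [MeasurableSpace Ω] {P : Measure Ω} [IsProbabilityMeasure P]
  {X : Ω → (Fin N → ℝ)} {g : (Fin N → ℝ) → ℝ} {K : ℕ}

/-- The linear functional on polynomials sending `∏ i, X i ^ a i` to `E a`. -/
noncomputable def monomialFunctional (E : (Fin N → ℕ) → ℝ) : MvPolynomial (Fin N) ℝ →ₗ[ℝ] ℝ :=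
  (MvPolynomial.basisMonomials (Fin N) ℝ).constr ℝ fun a => E a

lemma monomialFunctional_prod (E : (Fin N → ℕ) → ℝ) (a : Fin N → ℕ) :
    monomialFunctional E (∏ i, MvPolynomial.X i ^ a i) = E a := by
  have h : ∏ i, (MvPolynomial.X i : MvPolynomial (Fin N) ℝ) ^ a i =
      MvPolynomial.basisMonomials (Fin N) ℝ (Finsupp.equivFunOnFinite.symm a) := by
    rw [MvPolynomial.coe_basisMonomials]
    dsimp only
    rw [MvPolynomial.monomial_eq, MvPolynomial.C_1, one_mul,
      Finsupp.prod_fintype _ _ (by simp)]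
    simp
  rw [h, monomialFunctional, Module.Basis.constr_basis]
  simp

lemma prod_X_pow_add_single (a : Fin N → ℕ) (i : Fin N) :
    ∏ k, (MvPolynomial.X k : MvPolynomial (Fin N) ℝ) ^ (a + Pi.single i 1 : Fin N → ℕ) k =
      (∏ k, MvPolynomial.X k ^ a k) * MvPolynomial.X i := by
  simp only [Pi.add_apply, pow_add, Finset.prod_mul_distrib]
  congr 1
  rw [Finset.prod_eq_single i]
  · simp
  · intro k _ hk; simp [hk]
  · simp

lemma prod_factorial_add_single (b : Fin N → ℕ) (j : Fin N) :
    ∏ k, (((b + Pi.single j 1 : Fin N → ℕ) k)! : ℝ) = (∏ k, ((b k)! : ℝ)) * (b j + 1 : ℕ) := by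
  rw [← Finset.mul_prod_erase _ _ (Finset.mem_univ j),
    ← Finset.mul_prod_erase _ (fun k => ((b k)! : ℝ)) (Finset.mem_univ j)]
  have : ∏ x ∈ Finset.univ.erase j, (((b + Pi.single j 1 : Fin N → ℕ) x)! : ℝ) =
      ∏ x ∈ Finset.univ.erase j, ((b x)! : ℝ) := by
    refine Finset.prod_congr rfl fun k hk => ?_
    simp [(Finset.mem_erase.1 hk).1]
  rw [this]
  simp only [Pi.add_apply, Pi.single_eq_same, Nat.factorial_succ]
  push_cast
  ring

/-- Under the functional, multiplication by `Xᵢ` is differentiation by `∂ᵢ`. After division by `b!`,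
Stein's identity is then exactly the recursion of the exponential coefficients, and induction on
`|b|` identifies the two sides. Arbitrary `a` is needed because each step may raise it. -/
theorem integral_monomial_mul_mixedPartial (hX : HasGaussianLaw X P) (hg : ContDiff ℝ K g)
    (hint : ∀ a : Fin N → ℕ, ∑ i, a i ≤ K → Integrable (fun ω => mixedPartial a g (X ω)) P)
    (μ : Fin N → ℝ) (hμ : ∀ i, ∫ ω, X ω i ∂P = μ i) (C : Matrix (Fin N) (Fin N) ℝ)
    (hC : ∀ i j, cov[fun ω => X ω i, fun ω => X ω j; P] = C i j)
    (b a : Fin N → ℕ) (hK : ∑ i, b i + ∑ i, a i ≤ K) :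
    ∫ ω, (∏ k, X ω k ^ b k) * mixedPartial a g (X ω) ∂P =
      (∏ k, ((b k)! : ℝ)) * monomialFunctional (fun a => ∫ ω, mixedPartial a g (X ω) ∂P)
        ((∏ i, MvPolynomial.X i ^ a i) * exponentialCoeff blockDegree (blockWeight μ C) b) := by
  have hCs : ∀ i j, C i j = C j i := fun i j => by rw [← hC, ← hC, covariance_comm]
  have hI := integrable_monomial_mul_mixedPartial hX hg hint
  set Λ := monomialFunctional (fun a => ∫ ω, mixedPartial a g (X ω) ∂P)
  set W := exponentialCoeff blockDegree (blockWeight μ C)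
  suffices H : ∀ s : ℕ, ∀ (b a : Fin N → ℕ), ∑ i, b i ≤ s → ∑ i, b i + ∑ i, a i ≤ K →
      ∫ ω, (∏ k, X ω k ^ b k) * mixedPartial a g (X ω) ∂P =
        (∏ k, ((b k)! : ℝ)) * Λ ((∏ i, MvPolynomial.X i ^ a i) * W b) from
    H _ b a le_rfl hK
  intro s
  induction s with
  | zero =>
    intro b a hb _
    have : b = 0 := by
      ext i
      have : ∀ i, b i = 0 := by simpa using hb
      simp [this]
    subst this
    simp only [W, exponentialCoeff_zero blockDegree_ne_zero, mul_one, Λ, monomialFunctional_prod]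
    simp
  | succ s ih =>
    intro b a hb ha
    by_cases h : ∃ j, b j ≠ 0
    swap
    · push Not at h
      exact ih b a (by simp [h]) ha
    obtain ⟨j, hj⟩ := h
    have hs := sum_sub_single hj
    obtain ⟨b', hb'⟩ : ∃ b', b' = b - Pi.single j 1 := ⟨_, rfl⟩
    have hbb : b = b' + Pi.single j 1 := by rw [hb', sub_single_add_single hj]
    rw [← hb'] at hs
    clear hb' hj
    subst hbb
    have hrec := (stein_monomial hX hg b' a (by omega) j (hI _ _ (by omega))
      (fun i hi => hI _ _ (by have := sum_sub_single hi; omega))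
      (fun i => hI _ _ (by rw [sum_add_single]; omega))).2
    rw [hrec, hμ, prod_factorial_add_single, mul_assoc]
    have hW := congrArg (fun w => Λ ((∏ i, MvPolynomial.X i ^ a i) * w))
      (smul_exponentialCoeff_block μ hCs b' j)
    simp only [mul_add, Finset.mul_sum, mul_smul_comm, map_add, map_sum, map_smul, smul_eq_mul]
      at hW
    rw [hW, ih b' a (by omega) (by omega)]
    simp only [mul_add, Finset.sum_add_distrib, Finset.mul_sum]
    have t1 : ∀ i, C j i * ∫ ω, (∏ k, X ω k ^ b' k) * mixedPartial (a + Pi.single i 1) g (X ω) ∂P =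
        (∏ k, ((b' k)! : ℝ)) * (C j i * Λ ((∏ i, MvPolynomial.X i ^ a i) *
          (MvPolynomial.X i * W b'))) := fun i => by
      rw [ih b' _ (by omega) (by rw [sum_add_single]; omega), prod_X_pow_add_single, mul_assoc]
      ring
    -- The factor `b' i` restores `b'!` from `(b' - eᵢ)!`, and kills the term when the subtraction
    -- truncates.
    have t2 : ∀ i, C j i * (b' i *
        ∫ ω, (∏ k, X ω k ^ (b' - Pi.single i 1 : Fin N → ℕ) k) * mixedPartial a g (X ω) ∂P) =
        (∏ k, ((b' k)! : ℝ)) * (C j i * Λ ((∏ i, MvPolynomial.X i ^ a i) *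
          (if b' i ≠ 0 then W (b' - Pi.single i 1) else 0))) := fun i => by
      by_cases hi : b' i = 0
      · simp [hi]
      · have hsi := sum_sub_single hi
        rw [if_pos hi, ih _ a (by omega) (by omega)]
        have hf := prod_factorial_add_single (b' - Pi.single i 1) i
        rw [sub_single_add_single hi] at hf
        rw [hf]
        have : (b' - Pi.single i 1 : Fin N → ℕ) i + 1 = b' i := by simp; omega
        rw [this]
        ring
    simp only [hC, t1, t2]
    ring

end MomentFormula

/-! ### From block multiplicities to the arrays `r`, `ℓ`, `k` -/

section Reindexing

variable {N : ℕ}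

lemma prod_sym2_eq {M : Type*} [CommMonoid M] (f : Sym2 (Fin N) → M) :
    ∏ s, f s = (∏ i, f s(i, i)) * ∏ i, ∏ j ∈ Finset.Ioi i, f s(i, j) := by
  rw [← Finset.prod_mul_distrib]
  have h : ∀ i : Fin N, f s(i, i) * ∏ j ∈ Finset.Ioi i, f s(i, j) =
      ∏ j ∈ Finset.univ.filter (fun j => i ≤ j), f s(i, j) := by
    intro i
    have : Finset.univ.filter (fun j => i ≤ j) = insert i (Finset.Ioi i) := by
      ext j; simp [le_iff_eq_or_lt, eq_comm (a := i)]
    rw [this, Finset.prod_insert (by simp)]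
  simp only [h, Finset.prod_filter]
  rw [← Fintype.prod_prod_type' (f := fun i j => if i ≤ j then f s(i, j) else 1),
    ← Finset.prod_filter, ← Equiv.prod_comp (Sym2.sortEquiv (α := Fin N)).symm]
  exact (Finset.prod_subtype (p := fun p : Fin N × Fin N => p.1 ≤ p.2) _
    (fun p => by simp) (fun p => f s(p.1, p.2))).symm

lemma prod_prod_eq_diag_mul {M : Type*} [CommMonoid M] (f : Fin N → Fin N → M) :
    ∏ i, ∏ j, f i j = (∏ i, f i i) * ∏ i, ∏ j ∈ Finset.Ioi i, f i j * f j i := by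
  rw [Finset.prod_prod_Ioi_mul_eq_prod_prod_off_diag fun i j => f j i,
    ← Finset.prod_mul_distrib]
  refine Finset.prod_congr rfl fun i _ => ?_
  rw [Fintype.prod_eq_mul_prod_compl i]

/-- The families `(r, ℓ)` recorded by the multiplicities of the building blocks. -/
def decompositionOf (m : BlockIndex N → ℕ) : (Fin N → ℕ) × (Fin N → Fin N → ℕ) :=
  (fun i => m (.inl i), fun i j => m (.inr (.inl (i, j))) +
    (1 + if i = j then 1 else 0) * m (.inr (.inr s(i, j))))

/-- The array `k` recorded by the multiplicities of the building blocks. -/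
def pairingOf (m : BlockIndex N → ℕ) : Fin N → Fin N → ℕ :=
  fun i j => m (.inr (.inr s(i, j)))

/-- The multiplicities of the building blocks determined by `(r, ℓ)` and `k`. -/
def multiplicityOf (p : (Fin N → ℕ) × (Fin N → Fin N → ℕ)) (k : Fin N → Fin N → ℕ) :
    BlockIndex N → ℕ
  | .inl i => p.1 i
  | .inr (.inl q) => p.2 q.1 q.2 - (1 + if q.1 = q.2 then 1 else 0) * k q.1 q.2
  | .inr (.inr s) => Sym2.lift ⟨fun i j => min (k i j) (k j i), fun _ _ => min_comm _ _⟩ s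

lemma sum_smul_blockDegree_apply (m : BlockIndex N → ℕ) (i : Fin N) :
    (∑ α, m α • blockDegree α) i =
      (decompositionOf m).1 i + ∑ j, (decompositionOf m).2 i j := by
  simp only [Finset.sum_apply, Pi.smul_apply, smul_eq_mul, Fintype.sum_sum_type,
    decompositionOf, Finset.sum_add_distrib]
  congr 1
  · rw [Finset.sum_eq_single i]
    · simp [blockDegree]
    · intro k _ hk; simp [blockDegree, hk.symm]
    · simp
  congr 1
  · rw [Fintype.sum_prod_type, Finset.sum_eq_single i]
    · simp [blockDegree]
    · intro k _ hk; simp [blockDegree, hk.symm]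
    · simp
  · simp only [blockDegree]
    rw [sum_sym2_eq_sum_mk i (fun s => m (.inr (.inr s)) * pairDegree s i) (fun s hs => by simp [hs])]
    refine Finset.sum_congr rfl fun j _ => ?_
    rw [Sym2.eq_swap, pairDegree_mk, mul_comm]
    simp [Pi.single_apply]

lemma mem_decompositions {n : Fin N → ℕ} {p : (Fin N → ℕ) × (Fin N → Fin N → ℕ)} :
    p ∈ decompositions n ↔ ∀ i, p.1 i + ∑ j, p.2 i j = n i := by
  simp only [decompositions, Finset.mem_filter, Finset.mem_product, Fintype.mem_piFinset,
    Finset.mem_range, and_iff_right_iff_imp]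
  refine fun h => ⟨fun i => by have := h i; omega, fun i j => ?_⟩
  have := h i
  have := Finset.single_le_sum (f := p.2 i) (fun _ _ => Nat.zero_le _) (Finset.mem_univ j)
  omega

/-- This form treats diagonal and off-diagonal entries alike and says exactly that `ℓᵢⱼ - (1 + δᵢⱼ)
kᵢⱼ` does not truncate; symmetry of `k` recovers the minimum. -/
lemma mem_pairings {l k : Fin N → Fin N → ℕ} :
    k ∈ pairings l ↔ (∀ i j, (1 + if i = j then 1 else 0) * k i j ≤ l i j) ∧
      ∀ i j, k i j = k j i := by
  simp only [pairings, Finset.mem_filter, Fintype.mem_piFinset, Finset.mem_range, maxPairing]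
  refine and_congr_left fun hs => ⟨fun h i j => ?_, fun h i j => ?_⟩
  · have := h i j
    split_ifs at this ⊢ with hij
    · subst hij; omega
    · omega
  · have h1 := h i j
    have h2 := h j i
    rw [← hs i j] at h2
    by_cases hij : i = j
    · subst hij
      simp only [if_true] at h1 ⊢
      omega
    · simp only [if_neg hij, if_neg (Ne.symm hij)] at h1 h2 ⊢
      omega

lemma sum_weightedMultiplicities (n : Fin N → ℕ)
    (f : (Fin N → ℕ) × (Fin N → Fin N → ℕ) → (Fin N → Fin N → ℕ) → ℝ) :
    ∑ m ∈ weightedMultiplicities blockDegree n, f (decompositionOf m) (pairingOf m) =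
      ∑ p ∈ decompositions n, ∑ k ∈ pairings p.2, f p k := by
  rw [Finset.sum_sigma']
  refine Finset.sum_nbij' (fun m => ⟨decompositionOf m, pairingOf m⟩)
    (fun q => multiplicityOf q.1 q.2) ?_ ?_ ?_ ?_ (fun _ _ => rfl)
  · intro m hm
    rw [mem_weightedMultiplicities blockDegree_ne_zero] at hm
    rw [Finset.mem_sigma, mem_decompositions, mem_pairings]
    refine ⟨fun i => ?_, fun i j => ?_, fun i j => ?_⟩
    · rw [← sum_smul_blockDegree_apply, hm]
    · simp [decompositionOf, pairingOf]
    · simp [pairingOf, Sym2.eq_swap (a := i)]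
  · rintro ⟨p, k⟩ hq
    rw [Finset.mem_sigma, mem_decompositions, mem_pairings] at hq
    obtain ⟨h1, h2, h3⟩ := hq
    dsimp only at h1 h2 h3
    rw [mem_weightedMultiplicities blockDegree_ne_zero]
    ext i
    rw [sum_smul_blockDegree_apply, ← h1 i]
    congr 1
    refine Finset.sum_congr rfl fun j _ => ?_
    -- The minimum only makes `multiplicityOf` well defined on unordered pairs; for symmetric `k` it
    -- is `k i j`.
    simp only [decompositionOf, multiplicityOf, Sym2.lift_mk, ← h3 i j, min_self]
    exact Nat.sub_add_cancel (h2 i j)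
  · intro m _
    ext (i | q | s)
    · rfl
    · simp [multiplicityOf, decompositionOf, pairingOf]
    · induction s using Sym2.ind with
      | _ i j => simp [multiplicityOf, pairingOf, Sym2.eq_swap (a := j)]
  · rintro ⟨p, k⟩ hq
    rw [Finset.mem_sigma, mem_decompositions, mem_pairings] at hq
    obtain ⟨h1, h2, h3⟩ := hq
    dsimp only at h1 h2 h3
    have hk : pairingOf (multiplicityOf p k) = k := by
      ext i j
      simp [pairingOf, multiplicityOf, ← h3 i j]
    have hp : decompositionOf (multiplicityOf p k) = p := by
      refine Prod.ext rfl ?_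
      ext i j
      simp only [decompositionOf, multiplicityOf, Sym2.lift_mk, ← h3 i j, min_self]
      exact Nat.sub_add_cancel (h2 i j)
    simp only [hk, hp]

lemma derivOrder_decompositionOf (m : BlockIndex N → ℕ) (j : Fin N) :
    derivOrder (decompositionOf m).2 (pairingOf m) j = ∑ i, m (.inr (.inl (i, j))) := by
  refine Finset.sum_congr rfl fun i _ => ?_
  simp [decompositionOf, pairingOf, Sym2.eq_swap (a := j), eq_comm (a := j)]

lemma dividedMonomial_blockWeight (μ : Fin N → ℝ) (C : Matrix (Fin N) (Fin N) ℝ)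
    (m : BlockIndex N → ℕ) :
    dividedMonomial (blockWeight μ C) m =
      ((∏ i, ((m (.inl i))! : ℝ)⁻¹ * μ i ^ m (.inl i)) *
        ((∏ i, ∏ j, ((m (.inr (.inl (i, j))))! : ℝ)⁻¹ * C i j ^ m (.inr (.inl (i, j)))) *
        ∏ s, ((m (.inr (.inr s)))! : ℝ)⁻¹ * pairWeight C s ^ m (.inr (.inr s)))) •
      ∏ j, MvPolynomial.X j ^ derivOrder (decompositionOf m).2 (pairingOf m) j := by
  simp only [dividedMonomial, Fintype.prod_sum_type, Fintype.prod_prod_type, blockWeight,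
    MvPolynomial.smul_eq_C_mul, mul_pow, map_mul, map_prod, map_pow,
    derivOrder_decompositionOf, ← Finset.prod_pow_eq_pow_sum]
  rw [Finset.prod_comm (f := fun j i => (MvPolynomial.X j : MvPolynomial (Fin N) ℝ) ^ _)]
  simp only [Finset.prod_mul_distrib]
  ring

/-- With `ℓ = p + 2k`, `H / ℓ! = 1 / (p! k! 2^k)` and `ℓ - k = p + k`: `p` factors become
derivatives and `k` pairs have weight `c / 2`. -/
lemma coeffH_div_factorial (c : ℝ) (p k : ℕ) :
    ((p + 2 * k)! : ℝ)⁻¹ * (coeffH (p + 2 * k) k * c ^ (p + 2 * k - k)) =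
      ((p ! : ℝ)⁻¹ * c ^ p) * ((k ! : ℝ)⁻¹ * (c / 2) ^ k) := by
  have h1 : p + 2 * k - 2 * k = p := by omega
  have h2 : p + 2 * k - k = p + k := by omega
  rw [coeffH, h1, h2, div_pow, pow_add]
  have : ((p + 2 * k)! : ℝ) ≠ 0 := by positivity
  field_simp

/-- Here `G / (ℓ₁! ℓ₂!) = 1 / (p! q! k!)`: the `k` mixed pairs use one factor from each side,
leaving `p` and `q` derivatives. -/
lemma coeffG_div_factorial (c : ℝ) (p q k : ℕ) :
    (((p + k)! : ℝ) * ((q + k)! : ℝ))⁻¹ *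
        (coeffG (p + k) (q + k) k * c ^ (p + k + (q + k) - k)) =
      (((p ! : ℝ)⁻¹ * c ^ p) * ((q ! : ℝ)⁻¹ * c ^ q)) * ((k ! : ℝ)⁻¹ * c ^ k) := by
  have h2 : p + k + (q + k) - k = p + q + k := by omega
  rw [coeffG, h2, pow_add, pow_add, Nat.add_choose, Nat.add_choose,
    Nat.cast_div (Nat.factorial_mul_factorial_dvd_factorial_add p k) (by positivity),
    Nat.cast_div (Nat.factorial_mul_factorial_dvd_factorial_add q k) (by positivity)]
  push_cast
  field_simp

/-- The factorials `ℓᵢⱼ!` of the multinomial coefficients split into diagonal ones, absorbed by `H`,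
and pairs `ℓᵢⱼ! ℓⱼᵢ!` with `i < j`, absorbed by `G`. -/
lemma prod_factorial_mul_blockWeights {μ : Fin N → ℝ} {C : Matrix (Fin N) (Fin N) ℝ}
    (hC : ∀ i j, C i j = C j i) (n : Fin N → ℕ) (m : BlockIndex N → ℕ) :
    (∏ i, ((n i)! : ℝ)) * ((∏ i, ((m (.inl i))! : ℝ)⁻¹ * μ i ^ m (.inl i)) *
        ((∏ i, ∏ j, ((m (.inr (.inl (i, j))))! : ℝ)⁻¹ * C i j ^ m (.inr (.inl (i, j)))) *
        ∏ s, ((m (.inr (.inr s)))! : ℝ)⁻¹ * pairWeight C s ^ m (.inr (.inr s)))) =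
      (∏ i, multinomialCoeff (n i) ((decompositionOf m).1 i) ((decompositionOf m).2 i)) *
        (∏ i, μ i ^ (decompositionOf m).1 i) *
        ((∏ i, coeffH ((decompositionOf m).2 i i) (pairingOf m i i) *
            C i i ^ ((decompositionOf m).2 i i - pairingOf m i i)) *
          ∏ i, ∏ j ∈ Finset.Ioi i,
            coeffG ((decompositionOf m).2 i j) ((decompositionOf m).2 j i) (pairingOf m i j) *
              C i j ^ ((decompositionOf m).2 i j + (decompositionOf m).2 j i - pairingOf m i j)) := by
  have hmult : ∏ i, multinomialCoeff (n i) ((decompositionOf m).1 i) ((decompositionOf m).2 i) =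
      (∏ i, ((n i)! : ℝ)) * (∏ i, ((m (.inl i))! : ℝ)⁻¹) *
        ((∏ i, (((decompositionOf m).2 i i)! : ℝ)⁻¹) * ∏ i, ∏ j ∈ Finset.Ioi i,
          ((((decompositionOf m).2 i j)! : ℝ) * (((decompositionOf m).2 j i)! : ℝ))⁻¹) := by
    have := prod_prod_eq_diag_mul fun i j => (((decompositionOf m).2 i j)! : ℝ)⁻¹
    simp only [mul_inv]
    rw [← this]
    simp only [multinomialCoeff, div_eq_mul_inv, mul_inv, Finset.prod_mul_distrib,
      Finset.prod_inv_distrib]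
    rw [mul_assoc]
    rfl
  have hdiag : ∀ i, (((decompositionOf m).2 i i)! : ℝ)⁻¹ *
      (coeffH ((decompositionOf m).2 i i) (pairingOf m i i) *
        C i i ^ ((decompositionOf m).2 i i - pairingOf m i i)) =
      (((m (.inr (.inl (i, i))))! : ℝ)⁻¹ * C i i ^ m (.inr (.inl (i, i)))) *
      (((m (.inr (.inr s(i, i))))! : ℝ)⁻¹ * pairWeight C s(i, i) ^ m (.inr (.inr s(i, i)))) := by
    intro i
    have hw : pairWeight C s(i, i) = C i i / 2 := by simp [pairWeight]; ring
    have hl : (decompositionOf m).2 i i = m (.inr (.inl (i, i))) + 2 * pairingOf m i i := by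
      simp [decompositionOf, pairingOf]
    rw [hw, hl]
    exact coeffH_div_factorial _ _ _
  have hoff : ∀ i, ∀ j ∈ Finset.Ioi i,
      ((((decompositionOf m).2 i j)! : ℝ) * (((decompositionOf m).2 j i)! : ℝ))⁻¹ *
      (coeffG ((decompositionOf m).2 i j) ((decompositionOf m).2 j i) (pairingOf m i j) *
        C i j ^ ((decompositionOf m).2 i j + (decompositionOf m).2 j i - pairingOf m i j)) =
      ((((m (.inr (.inl (i, j))))! : ℝ)⁻¹ * C i j ^ m (.inr (.inl (i, j)))) *
        (((m (.inr (.inl (j, i))))! : ℝ)⁻¹ * C j i ^ m (.inr (.inl (j, i))))) *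
      (((m (.inr (.inr s(i, j))))! : ℝ)⁻¹ * pairWeight C s(i, j) ^ m (.inr (.inr s(i, j)))) := by
    intro i j hj
    have hij : i ≠ j := (Finset.mem_Ioi.1 hj).ne
    have hw : pairWeight C s(i, j) = C i j := by
      simp [pairWeight, hij, ← hC i j]
    have h1 : (decompositionOf m).2 i j = m (.inr (.inl (i, j))) + pairingOf m i j := by
      simp [decompositionOf, pairingOf, hij]
    have h2 : (decompositionOf m).2 j i = m (.inr (.inl (j, i))) + pairingOf m i j := by
      simp [decompositionOf, pairingOf, hij.symm, Sym2.eq_swap (a := j)]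
    rw [hw, h1, h2, ← hC i j]
    exact coeffG_div_factorial _ _ _ _
  rw [prod_sym2_eq, prod_prod_eq_diag_mul, hmult]
  have e1 := Finset.prod_congr (rfl : (Finset.univ : Finset (Fin N)) = Finset.univ)
    fun i _ => hdiag i
  have e2 := Finset.prod_congr (rfl : (Finset.univ : Finset (Fin N)) = Finset.univ)
    fun i _ => Finset.prod_congr rfl (hoff i)
  simp only [Finset.prod_mul_distrib] at e1 e2 ⊢
  have e3 := congrArg₂ (· * ·) e1 e2
  have e4 : ∏ i, μ i ^ (decompositionOf m).1 i = ∏ i, μ i ^ m (.inl i) := rfl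
  rw [e4]
  linear_combination (-(∏ i, ((n i)! : ℝ)) * (∏ i, ((m (.inl i))! : ℝ)⁻¹) *
    ∏ i, μ i ^ m (.inl i)) * e3

end Reindexing

end GaussianFormula

/-! ### The generalizing formula -/

theorem theorem2 {Ω : Type*} [MeasurableSpace Ω] (P : Measure Ω) [IsProbabilityMeasure P]
    (N : ℕ) (X : Ω → (Fin N → ℝ)) (hX : HasGaussianLaw X P)
    (μ : Fin N → ℝ) (hμ : ∀ i, ∫ ω, X ω i ∂P = μ i)
    (C : Matrix (Fin N) (Fin N) ℝ)
    (hC : ∀ i j, covariance (fun ω => X ω i) (fun ω => X ω j) P = C i j)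
    (n : Fin N → ℕ)
    (g : (Fin N → ℝ) → ℝ) (hg : ContDiff ℝ (∑ i, n i : ℕ) g)
    (hint : Integrable (fun ω => g (X ω) * ∏ i, X ω i ^ n i) P)
    (hint' : ∀ p ∈ decompositions n, ∀ k ∈ pairings p.2,
      Integrable (fun ω => mixedPartial (derivOrder p.2 k) g (X ω)) P) :
    ∫ ω, g (X ω) * ∏ i, X ω i ^ n i ∂P =
      ∑ p ∈ decompositions n,
        (∏ i, multinomialCoeff (n i) (p.1 i) (p.2 i)) * (∏ i, μ i ^ p.1 i) *
          ∑ k ∈ pairings p.2,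
            (∏ i, coeffH (p.2 i i) (k i i) * C i i ^ (p.2 i i - k i i)) *
            (∏ i, ∏ j ∈ Finset.Ioi i,
              coeffG (p.2 i j) (p.2 j i) (k i j) * C i j ^ (p.2 i j + p.2 j i - k i j)) *
            ∫ ω, mixedPartial (derivOrder p.2 k) g (X ω) ∂P := by
  have hCs : ∀ i j, C i j = C j i := fun i j => by rw [← hC, ← hC, covariance_comm]
  have hmain := integral_monomial_mul_mixedPartial hX hg
    (integrable_mixedPartial_of_le n hint') μ hμ C hC n 0 (by simp)
  have hl : ∫ ω, g (X ω) * ∏ i, X ω i ^ n i ∂P =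
      ∫ ω, (∏ i, X ω i ^ n i) * mixedPartial 0 g (X ω) ∂P := by
    simp only [mixedPartial_zero, mul_comm]
  rw [hl, hmain]
  simp only [Finset.mul_sum]
  rw [← sum_weightedMultiplicities n fun p k =>
    (∏ i, multinomialCoeff (n i) (p.1 i) (p.2 i)) * (∏ i, μ i ^ p.1 i) *
      ((∏ i, coeffH (p.2 i i) (k i i) * C i i ^ (p.2 i i - k i i)) *
        (∏ i, ∏ j ∈ Finset.Ioi i,
          coeffG (p.2 i j) (p.2 j i) (k i j) * C i j ^ (p.2 i j + p.2 j i - k i j)) *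
        ∫ ω, mixedPartial (derivOrder p.2 k) g (X ω) ∂P)]
  simp only [exponentialCoeff, Pi.zero_apply, pow_zero, Finset.prod_const_one, one_mul, map_sum,
    Finset.mul_sum]
  refine Finset.sum_congr rfl fun m _ => ?_
  rw [dividedMonomial_blockWeight, map_smul, monomialFunctional_prod, smul_eq_mul, ← mul_assoc,
    prod_factorial_mul_blockWeights hCs]
  ring
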